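/- Let $k\ge 1$ and let $n_1,\dots,n_k$ be nonzero integers such that the pretzel link $K=P(n_1,\dots,n_k)$ is a knot. Let $D$ be its standard diagram: $k$ vertical columns of crossings side by side, the $i$-th column having $|n_i|$ crossings stacked vertically and joined to each other; the upper right (lower right) end of each column is joined to the upper left (lower left) end of the next column, and the ends of the last column are joined to those of the first one by an arc above and an arc below the diagram. At the crossings of the $i$-th column the strand running from south-west to north-east is the overcrossing one if $n_i>0$, and the undercrossing one if $n_i<0$. Orient $D$. Label the $n=|n_1|+\dots+|n_k|$ crossings by $1,\dots,n$, column by column from left to right, downward in the first column and upward in all other columns. Checkerboard colour the faces of $D$ so that the northern and southern corners of every crossing are black and the western and eastern ones white. The overlaid Tait graph is the plane bipartite graph with vertex classes the crossings and the faces of $D$, having one edge for every corner of every crossing, which joins the crossing to the face containing that corner. Its balanced version $\Gamma$ is obtained by deleting two faces: the unbounded (universal) face and the upper deck, i.e. the black face below the upper arc that touches the tops of all columns. Give each edge $\varepsilon$ of $\Gamma$, between a crossing $x$ and a face $f$, the following three weights. * Activity weight $\alpha(\varepsilon)$. It is one of the letters $L,D,\ell,d$ if $x$ lies in a column with $n_i>0$,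 and one of the barred letters $\overline L,\overline D,\overline\ell,\overline d$ if $n_i<0$. The letter is $L$ or $D$ (resp. barred) if $f$ is black and $\ell$ or $d$ if $f$ is white; it is $L$ or $\ell$ if $x$ has the lowest label among all crossings incident with $f$, and $D$ or $d$ otherwise. The letters are evaluated, with $A=t^{-1/4}$, as $$L=-A^{-3},\quad D=A,\quad \ell=-A^{3},\quad d=A^{-1},\quad \overline L=-A^{3},\quad \overline D=A^{-1},\quad \overline\ell=-A^{-3},\quad \overline d=A.$$ * Writhe weight $w(\varepsilon)=(-A)^{-3}$ if $x$ is a positive crossing of the oriented diagram and $(-A)^{3}$ if it is a negative one. * Sign $\kappa(\varepsilon)=-1$ if $\varepsilon$ lies in the corner of $x$ between the two outgoing strands, and $\kappa(\varepsilon)=+1$ otherwise. The signed enhanced activity matrix is the matrix with rows indexed by the crossings and columns indexed by the faces of $D$ other than the two deleted ones, whose entry at $(x,f)$ is the sum of $\kappa(\varepsilon)\,w(\varepsilon)\,\alpha(\varepsilon)$ over the edges $\varepsilon$ of $\Gamma$ between $x$ and $f$ (and $0$ if there are none). Then this matrix is square, of size $n\times n$, and for every ordering of its rows and columns its determinant equals,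 up to sign, the Jones polynomial $$V_K(t)=(-A^{-3})^{w(D)}\langle D\rangle ,\qquad A=t^{-1/4},$$ where $w(D)$ is the writhe of $D$ and $\langle D\rangle$ is its Kauffman bracket, normalized by $\langle \text{unknot without crossings}\rangle=1$, with $\langle D\rangle=A\langle D_0\rangle+A^{-1}\langle D_\infty\rangle$ for the $A$- and $B$-smoothings $D_0,D_\infty$ of a crossing and $\langle U\sqcup D\rangle=(-A^2-A^{-2})\langle D\rangle$ for an additional crossingless circle $U$. -/

import Mathlib

/-! # Link diagrams, Kauffman bracket, Jones polynomial, activity matrix, pretzel diagrams -/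

noncomputable section

/-- Parity of a position around a crossing. -/
def evenPos (p : Fin 4) : Bool := p.val % 2 == 0

/-- A checkerboard-coloured link diagram on an oriented surface, with set of crossings `C`, given
combinatorially.  The four half-edges (darts) at a crossing `x` are `(x, 0), (x, 1), (x, 2), (x, 3)`
in counterclockwise order, and `nbr` pairs the two darts of each edge of the projection graph.
The same pairs also name the corners: the corner `(x, p)` is the sector at `x` between the darts
`(x, p)` and `(x, p + 1)`.  The numbering is chosen so that the corners `0, 2` are black and
`1, 3` are white; this is what `nbr_parity` expresses.  `overEven x` says whether the overcrossing
strand at `x` consists of the darts `0, 2` or of the darts `1, 3`. -/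
structure LinkDiagram (C : Type) where
  nbr : C × Fin 4 → C × Fin 4
  nbr_nbr : ∀ d, nbr (nbr d) = d
  nbr_parity : ∀ d, evenPos (nbr d).2 = !evenPos d.2
  overEven : C → Bool

namespace LinkDiagram

variable {C : Type} (D : LinkDiagram C)

/-! ## Components and orientations -/

/-- Two darts are consecutive on a link component: they form an edge, or they are opposite at a
crossing. -/
def StrandStep (d d' : C × Fin 4) : Prop := d' = D.nbr d ∨ d' = (d.1, d.2 + 2)

/-- The components of the link. -/
def Component : Type := Quot D.StrandStep

/-- The diagram represents a knot. -/
def IsKnot : Prop := Nat.card D.Component = 1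

/-- An orientation of the link: `out d` says that the strand runs along the dart `d` away from
its crossing. -/
structure Orientation where
  out : C × Fin 4 → Bool
  out_nbr : ∀ d, out (D.nbr d) = !out d
  out_opp : ∀ x p, out (x, p + 2) = !out (x, p)

/-- The dart in position `p` at `x` belongs to the overcrossing strand. -/
def IsOver (x : C) (p : Fin 4) : Prop := evenPos p = D.overEven x

variable {D} in
/-- A crossing is positive if the outgoing under-dart follows the outgoing over-dart
counterclockwise. -/
def Orientation.IsPositive (o : D.Orientation) (x : C) : Prop :=
  ∃ p : Fin 4, D.IsOver x p ∧ o.out (x, p) = true ∧ o.out (x, p + 1) = true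

open Classical in
variable {D} in
/-- The contribution `±1` of a crossing to the writhe. -/
def Orientation.sign (o : D.Orientation) (x : C) : ℤ := if o.IsPositive x then 1 else -1

variable {D} in
/-- The writhe of an oriented diagram. -/
def Orientation.writhe [Fintype C] (o : D.Orientation) : ℤ := ∑ x, o.sign x

/-! ## Kauffman bracket and Jones polynomial

The ring `ℤ[t^(1/4), t^(-1/4)]` is `LaurentPolynomial ℤ`, with `T m` standing for `t^(m/4)`. -/

/-- `A = t^(-1/4)`, as a unit. -/
def varA : (LaurentPolynomial ℤ)ˣ where
  val := LaurentPolynomial.T (-1)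
  inv := LaurentPolynomial.T 1
  val_inv := by rw [← LaurentPolynomial.T_add]; simp
  inv_val := by rw [← LaurentPolynomial.T_add]; simp

/-- The dart joined to position `p` by a smoothing of a crossing.  If `b` is true, the smoothing
joins `0` to `1` and `2` to `3` (so it merges the white corners `1`, `3` and separates the black
ones); if `b` is false it joins `1` to `2` and `3` to `0`. -/
def smoothPos (b : Bool) (p : Fin 4) : Fin 4 := if evenPos p = b then p + 1 else p - 1

/-- The smoothing of the crossing `x`: the `A`-smoothing for `a = true`, the `B`-smoothing for
`a = false`.  The `A`-smoothing merges the two corners that the overcrossing strand sweeps when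
it is turned counterclockwise: these are `0, 2` if the darts `0, 2` are over, else `1, 3`. -/
def smooth (x : C) (a : Bool) (p : Fin 4) : Fin 4 := smoothPos (xor a (D.overEven x)) p

/-- Consecutive darts on a loop of the smoothed diagram of the state `s`
(`s x = true` for an `A`-smoothing at `x`). -/
def LoopStep (s : C → Bool) (d d' : C × Fin 4) : Prop :=
  d' = D.nbr d ∨ d' = (d.1, D.smooth d.1 (s d.1) d.2)

/-- The number of loops of a state. -/
def loops (s : C → Bool) : ℕ := Nat.card (Quot (D.LoopStep s))

/-- The Kauffman bracket, normalized to be `1` on the unknot diagram without crossings. -/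
def bracket [Fintype C] [DecidableEq C] : LaurentPolynomial ℤ :=
  ∑ s : C → Bool, ((∏ x, if s x then varA else varA⁻¹ : (LaurentPolynomial ℤ)ˣ) :
      LaurentPolynomial ℤ) *
    (-((varA ^ (2 : ℤ) : (LaurentPolynomial ℤ)ˣ) : LaurentPolynomial ℤ)
      - ((varA ^ (-2 : ℤ) : (LaurentPolynomial ℤ)ˣ) : LaurentPolynomial ℤ)) ^ (D.loops s - 1)

variable {D} in
/-- The Jones polynomial `(-A⁻³)^w ⟨D⟩` with `A = t^(-1/4)`. -/
def Orientation.jones [Fintype C] [DecidableEq C] (o : D.Orientation) : LaurentPolynomial ℤ :=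
  (((-(varA ^ (-3 : ℤ))) ^ o.writhe : (LaurentPolynomial ℤ)ˣ) : LaurentPolynomial ℤ) * D.bracket

/-! ## Faces of the projection graph -/

/-- The next corner of the same face, running along the edge of the dart `(x, p)`. -/
def nextCorner (c : C × Fin 4) : C × Fin 4 := ((D.nbr c).1, (D.nbr c).2 - 1)

/-- The faces of the projection graph. -/
def Face : Type := Quot fun c c' : C × Fin 4 => c' = D.nextCorner c

/-- The face in which a corner lies. -/
def face (c : C × Fin 4) : D.Face := Quot.mk _ c

/-- The checkerboard colour of a face. -/
def Face.black {D : LinkDiagram C} : D.Face → Bool :=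
  Quot.lift (fun c => evenPos c.2) (by
    rintro c c' rfl
    have h := D.nbr_parity c
    revert h
    simp only [nextCorner]
    generalize (D.nbr c).2 = q
    generalize c.2 = p
    revert p q
    decide)

/-! ## The activity matrix

The overlaid Tait graph has an edge for every corner `(x, p)`; it joins the crossing `x` to the
face of that corner.  The vertices of the Tait graph are the black faces, those of its dual are
the white faces. -/

/-- Tutte's activity letters. -/
inductive ActivityLetter
  | L | D | l | d | Lbar | Dbar | lbar | dbar

/-- Evaluation of the activity letters for the Jones polynomial. -/
def ActivityLetter.eval : ActivityLetter → (LaurentPolynomial ℤ)ˣ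
  | .L => -(varA ^ (-3 : ℤ))
  | .D => varA
  | .l => -(varA ^ (3 : ℤ))
  | .d => varA ^ (-1 : ℤ)
  | .Lbar => -(varA ^ (3 : ℤ))
  | .Dbar => varA ^ (-1 : ℤ)
  | .lbar => -(varA ^ (-3 : ℤ))
  | .dbar => varA

/-- Sign of a crossing as an edge of the Tait graph: positive if turning the overcrossing strand
counterclockwise sweeps the black corners. -/
def taitPositive (x : C) : Bool := D.overEven x

/-- An edge of the overlaid Tait graph is live if its crossing has the lowest label among all
crossings incident with its face. -/
def IsLive (label : C → ℕ) (c : C × Fin 4) : Prop :=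
  ∀ c' : C × Fin 4, D.face c' = D.face c → label c.1 ≤ label c'.1

open Classical in
/-- The activity weighting of an edge of the overlaid Tait graph. -/
def activity (label : C → ℕ) (c : C × Fin 4) : ActivityLetter :=
  match D.taitPositive c.1, (D.face c).black, decide (D.IsLive label c) with
  | true, true, true => .L
  | true, true, false => .D
  | true, false, true => .l
  | true, false, false => .d
  | false, true, true => .Lbar
  | false, true, false => .Dbar
  | false, false, true => .lbar
  | false, false, false => .dbar

open Classical in
variable {D} in
/-- The writhe weighting of the edges at a crossing. -/
def Orientation.writheWeight (o : D.Orientation) (x : C) : (LaurentPolynomial ℤ)ˣ :=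
  if o.IsPositive x then (-varA) ^ (-3 : ℤ) else (-varA) ^ (3 : ℤ)

variable {D} in
/-- Kauffman's trick: an edge is negative if it lies in the corner between the two outgoing
darts. -/
def Orientation.kappa (o : D.Orientation) (c : C × Fin 4) : (LaurentPolynomial ℤ)ˣ :=
  if o.out c = true ∧ o.out (c.1, c.2 + 1) = true then -1 else 1

open Classical in
variable {D} in
/-- The signed enhanced activity matrix: the weighted bipartite adjacency matrix (crossings versus
faces) of the balanced overlaid Tait graph obtained by omitting the faces `f₁` and `f₂`. -/
def Orientation.activityMatrix (o : D.Orientation) (label : C → ℕ) (f₁ f₂ : D.Face) :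
    Matrix C {f : D.Face // f ≠ f₁ ∧ f ≠ f₂} (LaurentPolynomial ℤ) :=
  fun x f => ∑ p : Fin 4, if D.face (x, p) = f.1 then
    ((o.kappa (x, p) * o.writheWeight x * (D.activity label (x, p)).eval :
      (LaurentPolynomial ℤ)ˣ) : LaurentPolynomial ℤ) else 0

end LinkDiagram

/-! ## Pretzel diagrams -/

/-- The crossings of the standard diagram of `P(n_1, …, n_k)`: `⟨i, j⟩` is the crossing number `j`
from the top, starting with `0`, in the `i`-th column from the left. -/
abbrev PretzelCrossing {k : ℕ} (n : Fin k → ℤ) : Type := Σ i : Fin k, Fin (n i).natAbs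

section
variable {k : ℕ} (n : Fin k → ℤ) (hn : ∀ i, n i ≠ 0)

/-- The top crossing of a column. -/
def pretzelTop (i : Fin k) : PretzelCrossing n := ⟨i, 0, Int.natAbs_pos.2 (hn i)⟩

/-- The bottom crossing of a column. -/
def pretzelBottom (i : Fin k) : PretzelCrossing n :=
  ⟨i, (n i).natAbs - 1, Nat.sub_lt (Int.natAbs_pos.2 (hn i)) one_pos⟩

/-- The edges of the pretzel diagram.  The darts `0, 1, 2, 3` point north-east, north-west,
south-west and south-east.  Columns are numbered cyclically. -/
def pretzelNbr [NeZero k] : PretzelCrossing n × Fin 4 → PretzelCrossing n × Fin 4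
  | (⟨i, j⟩, 0) => if j.1 = 0 then (pretzelTop n hn (i + 1), 1)
      else (⟨i, j.1 - 1, by omega⟩, 3)
  | (⟨i, j⟩, 1) => if j.1 = 0 then (pretzelTop n hn (i - 1), 0)
      else (⟨i, j.1 - 1, by omega⟩, 2)
  | (⟨i, j⟩, 2) => if h : j.1 + 1 < (n i).natAbs then (⟨i, j.1 + 1, h⟩, 1)
      else (pretzelBottom n hn (i - 1), 3)
  | (⟨i, j⟩, 3) => if h : j.1 + 1 < (n i).natAbs then (⟨i, j.1 + 1, h⟩, 0)
      else (pretzelBottom n hn (i + 1), 2)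

/-- The standard diagram of `P(n_1, …, n_k)`: the strand from south-west to north-east is over in
the columns with `n_i > 0`, the other strand in the columns with `n_i < 0`.  The corners
`0, 1, 2, 3` of a crossing are north, west, south and east; north and south are black. -/
def pretzelDiagram [NeZero k] : LinkDiagram (PretzelCrossing n) where
  nbr := pretzelNbr n hn
  nbr_nbr := by
    rintro ⟨⟨i, j, hj⟩, p⟩
    match p with
    | 0 =>
      by_cases h : j = 0
      · subst h
        simp only [pretzelNbr, pretzelTop, if_true]
        exact congrArg (fun i => (pretzelTop n hn i, (0 : Fin 4))) (add_sub_cancel_right i 1)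
      · have h' : j - 1 + 1 = j := by omega
        simp [pretzelNbr, h, h', hj]
    | 1 =>
      by_cases h : j = 0
      · subst h
        simp only [pretzelNbr, pretzelTop, if_true]
        exact congrArg (fun i => (pretzelTop n hn i, (1 : Fin 4))) (sub_add_cancel i 1)
      · have h' : j - 1 + 1 = j := by omega
        simp [pretzelNbr, h, h', hj]
    | 2 =>
      by_cases h : j + 1 < (n i).natAbs
      · simp [pretzelNbr, h]
      · obtain rfl : j = (n i).natAbs - 1 := by omega
        have h1 := Int.natAbs_pos.2 (hn (i - 1))
        have h2 : ¬ (n (i - 1)).natAbs - 1 + 1 < (n (i - 1)).natAbs := by omega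
        simp only [pretzelNbr, h, pretzelBottom, h2, dite_false]
        exact congrArg (fun i => (pretzelBottom n hn i, (2 : Fin 4))) (sub_add_cancel i 1)
    | 3 =>
      by_cases h : j + 1 < (n i).natAbs
      · simp [pretzelNbr, h]
      · obtain rfl : j = (n i).natAbs - 1 := by omega
        have h1 := Int.natAbs_pos.2 (hn (i + 1))
        have h2 : ¬ (n (i + 1)).natAbs - 1 + 1 < (n (i + 1)).natAbs := by omega
        simp only [pretzelNbr, h, pretzelBottom, h2, dite_false]
        exact congrArg (fun i => (pretzelBottom n hn i, (3 : Fin 4))) (add_sub_cancel_right i 1)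
  nbr_parity := by
    rintro ⟨⟨i, j, hj⟩, p⟩
    match p with
    | 0 | 1 | 2 | 3 =>
      simp only [pretzelNbr]
      split_ifs <;> simp [evenPos]
  overEven := fun x => decide (0 < n x.1)

/-- The labels `1, …, n` of the crossings: column by column from left to right, downward in the
first column and upward in the others. -/
def pretzelLabel [NeZero k] (x : PretzelCrossing n) : ℕ :=
  (∑ i ∈ Finset.univ.filter (· < x.1), (n i).natAbs) +
    if x.1 = 0 then x.2.1 + 1 else (n x.1).natAbs - x.2.1

/-- The upper deck supported by the columns: the face north of the first column. -/
def upperDeck [NeZero k] : (pretzelDiagram n hn).Face :=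
  (pretzelDiagram n hn).face (pretzelTop n hn 0, 0)

/-- The universal (unbounded) face: the face west of the first column. -/
def universalFace [NeZero k] : (pretzelDiagram n hn).Face :=
  (pretzelDiagram n hn).face (pretzelTop n hn 0, 1)

end

end

/-!
Around every edge of the projection graph the product of the four corner signs is `-1`, for the
signs `κ` of any orientation as well as for a fixed pattern of signs at the crossings.  Hence the
two differ by signs of the crossings and of the faces, and up to sign the determinant is the writhe
factor times the determinant of an orientation-independent matrix.  In a suitable ordering the
bigons of each column form a bidiagonal block of this matrix; eliminating them leaves a `k × k`
matrix with a full first column and two cyclic diagonals, whose determinant is explicit.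

On the bracket side, call a crossing cut by a state if its smoothing separates the crossings above
it from those below it.  A column with `c > 0` cuts contributes `c - 1` loops between its cuts; if
some column is uncut, then the remaining loops are as many as the uncut columns, and otherwise there
are two of them, above and below all cuts.  So the state sum is a sum of two products over the
columns.  After multiplication by the loop value `δ = -A² - A⁻²`, both sides equal
`∏ (Sᵢ + δ aᵢ) + (δ² - 1) ∏ Sᵢ`, where `aᵢ` is the weight of the uncut smoothing of the `i`-th
column and `Sᵢ` is the state sum over its smoothings with at least one cut.
-/

/-! ## Determinants of bordered bidiagonal matrices -/

section Determinants

open Matrix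

variable {R : Type*} [CommRing R]

theorem det_eq_prod_diag_of_rank {m α : Type*} [Fintype m] [DecidableEq m] [LinearOrder α]
    (M : Matrix m m R) (rank : m → α) (h : ∀ x y, x ≠ y → rank x ≤ rank y → M x y = 0) :
    M.det = ∏ x, M x x := by
  have hM : M.BlockTriangular (OrderDual.toDual ∘ rank) := fun x y hxy =>
    h x y (fun e => hxy.ne (by rw [e])) (le_of_lt hxy)
  have diag (a : αᵒᵈ) : M.toSquareBlock (OrderDual.toDual ∘ rank) a =
      diagonal fun x : {x // (OrderDual.toDual ∘ rank) x = a} => M x x := by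
    ext x y
    rcases eq_or_ne x y with rfl | hxy
    · rw [diagonal_apply_eq, toSquareBlock_def, of_apply]
    · rw [diagonal_apply_ne _ hxy]
      exact h x y (Subtype.coe_injective.ne hxy) (y.2.trans x.2.symm).le
  rw [hM.det, ← Finset.prod_fiberwise_of_maps_to
    fun x _ => Finset.mem_image_of_mem (OrderDual.toDual ∘ rank) (Finset.mem_univ x)]
  refine Finset.prod_congr rfl fun a _ => ?_
  rw [diag, det_diagonal, Finset.prod_subtype _ (p := fun x => (OrderDual.toDual ∘ rank) x = a)
    (by simp)]

/-- The matrix with first column `β` whose other columns are bidiagonal, with the entries `Y i` on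
the diagonal and `-Z i` above it. -/
def borderedBidiagonal {k : ℕ} (β Y Z : Fin k → R) : Matrix (Fin k) (Fin k) R := of fun i j =>
  if j.val = 0 then β i else if j = i then Y i else if j.val = i.val + 1 then -Z i else 0

theorem det_borderedBidiagonal_one (β Y Z : Fin 1 → R) :
    (borderedBidiagonal β Y Z).det = β 0 := by
  simp [borderedBidiagonal]

theorem borderedBidiagonal_submatrix_succ_succ {k : ℕ} (β Y Z : Fin (k + 1) → R) :
    (borderedBidiagonal β Y Z).submatrix Fin.succ Fin.succ = of fun i j : Fin k =>
      if j = i then Y i.succ else if j.val = i.val + 1 then -Z i.succ else 0 := by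
  ext i j
  simp [borderedBidiagonal]

theorem borderedBidiagonal_submatrix_succ_succAbove_one {k : ℕ} (β Y Z : Fin (k + 2) → R) :
    (borderedBidiagonal β Y Z).submatrix Fin.succ (Fin.succAbove 1) =
      borderedBidiagonal (fun i => β i.succ) (fun i => Y i.succ) (fun i => Z i.succ) := by
  ext i j
  cases j using Fin.cases <;> simp [borderedBidiagonal]

theorem det_borderedBidiagonal_succ {k : ℕ} (β Y Z : Fin (k + 2) → R) :
    (borderedBidiagonal β Y Z).det = β 0 * ∏ i : Fin (k + 1), Y i.succ +
      Z 0 * (borderedBidiagonal (fun i => β i.succ) (fun i => Y i.succ)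
        (fun i => Z i.succ)).det := by
  have upper : ((borderedBidiagonal β Y Z).submatrix Fin.succ Fin.succ).det =
      ∏ i : Fin (k + 1), Y i.succ := by
    rw [borderedBidiagonal_submatrix_succ_succ,
      det_eq_prod_diag_of_rank _ OrderDual.toDual]
    · simp
    · intro i j hij hle
      have : j < i := lt_of_le_of_ne hle hij.symm
      simp [hij.symm, show j.val ≠ i.val + 1 by omega]
  rw [det_succ_row_zero, Fin.sum_univ_succ, Fin.sum_univ_succ, Finset.sum_eq_zero]
  · rw [Fin.succ_zero_eq_one, borderedBidiagonal_submatrix_succ_succAbove_one,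
      funext (Fin.zero_succAbove (n := k + 1)), upper]
    simp [borderedBidiagonal]
  · intro j _
    simp [borderedBidiagonal, Fin.ext_iff (a := j.succ.succ)]

theorem mul_det_borderedBidiagonal (δ : R) {k : ℕ} (X Y Z : Fin (k + 1) → R)
    (hZ : ∀ i, Z i = Y i + δ * X i) :
    δ * (borderedBidiagonal X Y Z).det = ∏ i, Z i - ∏ i, Y i := by
  induction k with
  | zero => simp [det_borderedBidiagonal_one, hZ, -det_unique]
  | succ k ih =>
    rw [det_borderedBidiagonal_succ, Fin.prod_univ_succ Z, Fin.prod_univ_succ Y]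
    linear_combination Z 0 * ih _ _ _ (fun i => hZ i.succ) -
      (∏ i : Fin (k + 1), Y i.succ) * hZ 0

theorem mul_det_borderedBidiagonal_of_first (δ : R) {k : ℕ} [NeZero k] (β X Y Z : Fin k → R)
    (hZ : ∀ i, Z i = Y i + δ * X i) (hβ₀ : β 0 = X 0 + δ * Y 0) (hβ : ∀ i, i ≠ 0 → β i = X i) :
    δ * (borderedBidiagonal β Y Z).det = ∏ i, Z i + (δ ^ 2 - 1) * ∏ i, Y i := by
  rcases k with _ | _ | k
  · exact absurd rfl (NeZero.ne 0)
  · rw [det_borderedBidiagonal_one, Fin.prod_univ_one, Fin.prod_univ_one]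
    linear_combination δ * hβ₀ - hZ 0
  · have rest := mul_det_borderedBidiagonal δ _ _ _ fun i : Fin (k + 1) => hZ i.succ
    rw [det_borderedBidiagonal_succ, funext fun i : Fin (k + 1) => hβ _ (Fin.succ_ne_zero i),
      Fin.prod_univ_succ Z, Fin.prod_univ_succ Y]
    linear_combination Z 0 * rest + (δ * ∏ i : Fin (k + 1), Y i.succ) * hβ₀ -
      (∏ i : Fin (k + 1), Y i.succ) * hZ 0

variable {ι : Type*} {m : ι → ℕ}

theorem sigma_fin_eq_of_not_lt {x y : Σ i, Fin (m i)} (h : x.1 = y.1)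
    (hx : ¬ x.2.1 + 1 < m x.1) (hy : ¬ y.2.1 + 1 < m y.1) : x = y := by
  obtain ⟨i, j⟩ := x
  obtain ⟨i', j'⟩ := y
  obtain rfl : i = i' := h
  have : j = j' := Fin.ext (by simp only at hx hy; omega)
  rw [this]

/-- The last rows of the blocks. -/
def lastRowEquiv (hm : ∀ i, 0 < m i) : ι ≃ {x : Σ i, Fin (m i) // ¬ x.2.1 + 1 < m x.1} where
  toFun i := ⟨⟨i, m i - 1, Nat.sub_lt (hm i) one_pos⟩, by simp only; omega⟩
  invFun x := x.1.1
  left_inv _ := rfl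
  right_inv x := Subtype.ext (sigma_fin_eq_of_not_lt rfl (by simp only; omega) x.2)

theorem prod_sigma_of_succ_lt [Fintype ι] {f : ι → R} (hm : ∀ i, 0 < m i) :
    ∏ x : {x : Σ i, Fin (m i) // x.2.1 + 1 < m x.1}, f x.1.1 = ∏ i, f i ^ (m i - 1) := by
  have hblock (i : ι) : ∏ j : Fin (m i), (if j.1 + 1 < m i then f i else 1) = f i ^ (m i - 1) := by
    obtain ⟨l, hl⟩ := Nat.exists_eq_succ_of_ne_zero (hm i).ne'
    rw [hl, Fin.prod_univ_castSucc]
    simp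
  rw [← Finset.prod_subtype (s := Finset.univ.filter fun x : Σ i, Fin (m i) => x.2.1 + 1 < m x.1)
    (by simp) fun x => f x.1, Finset.prod_filter, Fintype.prod_sigma]
  exact Finset.prod_congr rfl fun i _ => hblock i

variable [DecidableEq ι]

/-- The columns of `N` other than the last one of each block are lower bidiagonal, with the entries
`a i` on the diagonal and `-b i` below it in the block `i`. -/
def HasBidiagonalBlocks (a b : ι → R) (N : Matrix (Σ i, Fin (m i)) (Σ i, Fin (m i)) R) : Prop :=
  ∀ x y : Σ i, Fin (m i), y.2.1 + 1 < m y.1 → N x y =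
    if x.1 = y.1 then if x.2.1 = y.2.1 then a x.1 else if x.2.1 = y.2.1 + 1 then -b x.1 else 0
    else 0

/-- The row operations that clear, in the last row of each block, all columns but the last ones of
the blocks. -/
def columnElimination (a b : ι → R) : Matrix (Σ i, Fin (m i)) (Σ i, Fin (m i)) R :=
  of fun x z => if x.2.1 + 1 < m x.1 then if z = x then 1 else 0
    else if z.1 = x.1 then a x.1 ^ z.2.1 * b x.1 ^ (m x.1 - 1 - z.2.1) else 0

variable [Fintype ι]

theorem det_columnElimination (hm : ∀ i, 0 < m i) (a b : ι → R) :
    (columnElimination (m := m) a b).det = ∏ i, a i ^ (m i - 1) := by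
  rw [det_eq_prod_diag_of_rank _ fun x => x.2.1,
    ← Fintype.prod_subtype_mul_prod_subtype fun x : Σ i, Fin (m i) => x.2.1 + 1 < m x.1,
    ← (lastRowEquiv hm).prod_comp]
  · have inner (x : {x : Σ i, Fin (m i) // x.2.1 + 1 < m x.1}) :
        columnElimination a b x.1 x.1 = 1 := by simp [columnElimination, x.2]
    have last (i : ι) : columnElimination a b (lastRowEquiv hm i).1 (lastRowEquiv hm i).1 =
        a i ^ (m i - 1) := by
      simp [columnElimination, lastRowEquiv, show ¬ m i - 1 + 1 < m i by omega]
    simp only [inner, last, Finset.prod_const_one, one_mul]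
  · rintro ⟨i, j⟩ ⟨i', j'⟩ hne hle
    simp only [columnElimination, of_apply] at hle ⊢
    split_ifs with h1 h2 h3
    · exact absurd h2.symm hne
    · rfl
    · subst h3
      have h4 : ¬ j'.1 + 1 < m i' := by omega
      exact absurd (sigma_fin_eq_of_not_lt (x := ⟨i', j⟩) (y := ⟨i', j'⟩) rfl h1 h4) hne
    · rfl

variable {a b : ι → R} {N : Matrix (Σ i, Fin (m i)) (Σ i, Fin (m i)) R} {x y : Σ i, Fin (m i)}

theorem columnElimination_mul_apply_of_lt (hx : x.2.1 + 1 < m x.1) :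
    (columnElimination a b * N : Matrix _ _ R) x y = N x y := by
  simp [mul_apply, columnElimination, hx]

theorem columnElimination_mul_apply_of_not_lt (hx : ¬ x.2.1 + 1 < m x.1) :
    (columnElimination a b * N : Matrix _ _ R) x y =
      ∑ j : Fin (m x.1), a x.1 ^ j.1 * b x.1 ^ (m x.1 - 1 - j.1) * N ⟨x.1, j⟩ y := by
  rw [mul_apply, Fintype.sum_sigma, Finset.sum_eq_single x.1]
  · simp [columnElimination, hx]
  · intro i _ hi
    simp [columnElimination, hx, hi]
  · simp

namespace HasBidiagonalBlocks

theorem columnElimination_mul_apply_eq_zero (hN : HasBidiagonalBlocks a b N)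
    (hx : ¬ x.2.1 + 1 < m x.1) (hy : y.2.1 + 1 < m y.1) :
    (columnElimination a b * N : Matrix _ _ R) x y = 0 := by
  obtain ⟨i, j⟩ := x
  obtain ⟨i', j'⟩ := y
  rw [columnElimination_mul_apply_of_not_lt hx]
  simp only [hN _ ⟨i', j'⟩ hy]
  simp only at hy ⊢
  obtain rfl | h := eq_or_ne i i'
  · have hexp : m i - 1 - j'.1 = (m i - 1 - (j'.1 + 1)) + 1 := by omega
    rw [Finset.sum_eq_add j' ⟨j'.1 + 1, hy⟩ (by simp [Fin.ext_iff])]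
    · simp only [if_true, hexp, Nat.succ_ne_self, if_false]
      ring
    · rintro l - ⟨h1, h2⟩
      rw [if_pos rfl, if_neg (fun h => h1 (Fin.ext h)), if_neg (fun h => h2 (Fin.ext h)), mul_zero]
    · simp
    · simp
  · simp [h]

theorem det_inner_block (hN : HasBidiagonalBlocks a b N) (hm : ∀ i, 0 < m i) :
    (N.toSquareBlockProp fun x => x.2.1 + 1 < m x.1).det = ∏ i, a i ^ (m i - 1) := by
  rw [det_eq_prod_diag_of_rank _ fun x => x.1.2.1, ← prod_sigma_of_succ_lt hm]
  · refine Finset.prod_congr rfl fun x _ => ?_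
    simp [toSquareBlockProp_def, hN _ _ x.2]
  · rintro ⟨⟨i, j⟩, hx⟩ ⟨⟨i', j'⟩, hy⟩ hxy hle
    rw [toSquareBlockProp_def, of_apply, hN _ _ hy]
    simp only at hle ⊢
    split_ifs with h h1 h2
    · subst h
      exact absurd (by simp [Fin.ext h1]) hxy
    · omega
    all_goals rfl

theorem det_eq [IsDomain R] (hN : HasBidiagonalBlocks a b N) (hm : ∀ i, 0 < m i)
    (ha : ∀ i, a i ≠ 0) :
    N.det = (of fun i i' => ∑ j : Fin (m i), a i ^ j.1 * b i ^ (m i - 1 - j.1) *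
      N ⟨i, j⟩ ⟨i', m i' - 1, Nat.sub_lt (hm i') one_pos⟩).det := by
  have hne : ∏ i, a i ^ (m i - 1) ≠ 0 :=
    Finset.prod_ne_zero_iff.2 fun i _ => pow_ne_zero _ (ha i)
  refine mul_left_cancel₀ hne ?_
  rw [← det_columnElimination hm a b, ← det_mul,
    twoBlockTriangular_det _ (fun x : Σ i, Fin (m i) => x.2.1 + 1 < m x.1)
      fun x hx y hy => hN.columnElimination_mul_apply_eq_zero hx hy,
    det_columnElimination hm, ← hN.det_inner_block hm]
  congr 1
  · congr 1
    ext x y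
    exact columnElimination_mul_apply_of_lt x.2
  · rw [← det_submatrix_equiv_self (lastRowEquiv hm)]
    congr 1
    ext i i'
    exact columnElimination_mul_apply_of_not_lt (lastRowEquiv hm i).2

end HasBidiagonalBlocks

end Determinants

/-! ## The faces of the pretzel diagram -/

section Cyclic

variable {k : ℕ} [NeZero k]

theorem cyclic_induction {P : Fin k → Prop} (zero : P 0) (step : ∀ i, P i → P (i + 1))
    (i : Fin k) : P i := by
  obtain ⟨k, rfl⟩ := Nat.exists_eq_succ_of_ne_zero (NeZero.ne k)
  induction i using Fin.induction with
  | zero => exact zero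
  | succ i ih => exact Fin.coeSucc_eq_succ (a := i) ▸ step _ ih

theorem fin_lt_add_one_of_ne_zero {i : Fin k} (h : i + 1 ≠ 0) : i < i + 1 := by
  obtain ⟨k, rfl⟩ := Nat.exists_eq_succ_of_ne_zero (NeZero.ne k)
  exact Fin.lt_add_one_iff.2 (Fin.lt_last_iff_ne_last.2 fun e => h (by rw [e, Fin.last_add_one]))

theorem fin_sub_one_lt_of_ne_zero {i : Fin k} (h : i ≠ 0) : i - 1 < i :=
  (fin_lt_add_one_of_ne_zero (by rwa [sub_add_cancel])).trans_eq (sub_add_cancel i 1)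

theorem fin_eq_add_one_iff {i j : Fin k} (hj : j ≠ 0) : j = i + 1 ↔ j.val = i.val + 1 := by
  obtain ⟨k, rfl⟩ := Nat.exists_eq_succ_of_ne_zero (NeZero.ne k)
  rw [Fin.ext_iff, Fin.val_add_one]
  split_ifs with h
  · simp only [h, Fin.val_last, Fin.val_eq_zero_iff, hj, false_iff]
    omega
  · rfl

end Cyclic

section Faces

theorem LinkDiagram.face_eq_of_nbr_eq {C : Type} {D : LinkDiagram C} {d d' : C × Fin 4}
    (h : D.nbr d = d') :
    D.face d = D.face (d'.1, d'.2 - 1) ∧ D.face d' = D.face (d.1, d.2 - 1) := by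
  have h' : D.nbr d' = d := by rw [← h, D.nbr_nbr]
  constructor <;> refine Quot.sound ?_ <;> simp only [nextCorner, h, h']

variable {k : ℕ} {n : Fin k → ℤ}

theorem pretzelCrossing_ext {x y : PretzelCrossing n} (h : x.1 = y.1) (h' : x.2.1 = y.2.1) :
    x = y := by
  obtain ⟨i, j⟩ := x
  obtain ⟨i', j'⟩ := y
  obtain rfl : i = i' := h
  exact congrArg _ (Fin.ext h')

variable (hn : ∀ i, n i ≠ 0)

theorem eq_pretzelTop {x : PretzelCrossing n} (h : x.2.1 = 0) : x = pretzelTop n hn x.1 :=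
  pretzelCrossing_ext rfl h

theorem eq_pretzelBottom {x : PretzelCrossing n} (h : ¬ x.2.1 + 1 < (n x.1).natAbs) :
    x = pretzelBottom n hn x.1 :=
  sigma_fin_eq_of_not_lt rfl h (by simp only [pretzelBottom]; omega)

theorem pretzelBottom_not_lt (i : Fin k) :
    ¬ (pretzelBottom n hn i).2.1 + 1 < (n i).natAbs := by
  simp only [pretzelBottom]
  omega

theorem pretzelBottom_eq_iff {i : Fin k} {y : PretzelCrossing n} :
    pretzelBottom n hn i = y ↔ i = y.1 ∧ ¬ y.2.1 + 1 < (n y.1).natAbs := by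
  constructor
  · rintro rfl
    exact ⟨rfl, pretzelBottom_not_lt hn i⟩
  · rintro ⟨rfl, h⟩
    exact (eq_pretzelBottom hn h).symm

variable [NeZero k]

/-- The edges of the pretzel diagram, each in one direction: the arcs between the tops and between
the bottoms of neighbouring columns, and the left and right edges of the bigons. -/
inductive PretzelEdge : PretzelCrossing n × Fin 4 → PretzelCrossing n × Fin 4 → Prop
  | top (i) : PretzelEdge (pretzelTop n hn i, 0) (pretzelTop n hn (i + 1), 1)
  | bottom (i) : PretzelEdge (pretzelBottom n hn i, 3) (pretzelBottom n hn (i + 1), 2)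
  | left (i j) (h : j + 1 < (n i).natAbs) : PretzelEdge (⟨i, j, by omega⟩, 2) (⟨i, j + 1, h⟩, 1)
  | right (i j) (h : j + 1 < (n i).natAbs) : PretzelEdge (⟨i, j, by omega⟩, 3) (⟨i, j + 1, h⟩, 0)

theorem exists_pretzelEdge (d : PretzelCrossing n × Fin 4) :
    ∃ d', PretzelEdge hn d d' ∨ PretzelEdge hn d' d := by
  obtain ⟨x, p⟩ := d
  match p with
  | 0 =>
    obtain ⟨i, _ | j, hj⟩ := x
    · exact ⟨_, .inl (.top i)⟩
    · exact ⟨_, .inr (.right i j hj)⟩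
  | 1 =>
    obtain ⟨i, _ | j, hj⟩ := x
    · obtain ⟨i, rfl⟩ : ∃ i', i = i' + 1 := ⟨i - 1, (sub_add_cancel _ _).symm⟩
      exact ⟨_, .inr (.top i)⟩
    · exact ⟨_, .inr (.left i j hj)⟩
  | 2 =>
    by_cases h : x.2.1 + 1 < (n x.1).natAbs
    · exact ⟨_, .inl (.left x.1 x.2.1 h)⟩
    · obtain ⟨i, hi⟩ : ∃ i, x.1 = i + 1 := ⟨x.1 - 1, (sub_add_cancel _ _).symm⟩
      rw [eq_pretzelBottom hn h, hi]
      exact ⟨_, .inr (.bottom i)⟩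
  | 3 =>
    by_cases h : x.2.1 + 1 < (n x.1).natAbs
    · exact ⟨_, .inl (.right x.1 x.2.1 h)⟩
    · rw [eq_pretzelBottom hn h]
      exact ⟨_, .inl (.bottom x.1)⟩

theorem PretzelEdge.nbr_eq {d d' : PretzelCrossing n × Fin 4} (h : PretzelEdge hn d d') :
    (pretzelDiagram n hn).nbr d = d' := by
  cases h with
  | top i => simp [pretzelDiagram, pretzelNbr, pretzelTop]
  | bottom i => exact dif_neg (pretzelBottom_not_lt hn i)
  | left i j h => simp [pretzelDiagram, pretzelNbr, h]
  | right i j h => simp [pretzelDiagram, pretzelNbr, h]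

theorem pretzelEdge_cases {P : PretzelCrossing n × Fin 4 → PretzelCrossing n × Fin 4 → Prop}
    (symm : ∀ d d', P d d' → P d' d) (edge : ∀ d d', PretzelEdge hn d d' → P d d')
    (d : PretzelCrossing n × Fin 4) : P d ((pretzelDiagram n hn).nbr d) := by
  obtain ⟨d', h | h⟩ := exists_pretzelEdge hn d
  · exact h.nbr_eq ▸ edge _ _ h
  · obtain rfl := h.nbr_eq
    rw [LinkDiagram.nbr_nbr]
    exact symm _ _ (edge _ _ h)

theorem PretzelEdge.face_eq {d d' : PretzelCrossing n × Fin 4} (h : PretzelEdge hn d d') :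
    (pretzelDiagram n hn).face d = (pretzelDiagram n hn).face (d'.1, d'.2 - 1) ∧
      (pretzelDiagram n hn).face d' = (pretzelDiagram n hn).face (d.1, d.2 - 1) :=
  LinkDiagram.face_eq_of_nbr_eq h.nbr_eq

/-- A name for the face of a corner.  The upper deck is `inl true` and the universal face is
`inl false`.  The other faces are named by crossings: the bigon below a crossing by that crossing,
the face to the left of the column `i ≠ 0` by the bottom crossing of this column, and the face
below all columns by the bottom crossing of the column `0`. -/
def faceCode : PretzelCrossing n × Fin 4 → Bool ⊕ PretzelCrossing n
  | (x, 0) => if x.2.1 = 0 then .inl true else .inr ⟨x.1, x.2.1 - 1, by omega⟩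
  | (x, 1) => if x.1 = 0 then .inl false else .inr (pretzelBottom n hn x.1)
  | (x, 2) => if x.2.1 + 1 < (n x.1).natAbs then .inr x else .inr (pretzelBottom n hn 0)
  | (x, 3) => if x.1 + 1 = 0 then .inl false else .inr (pretzelBottom n hn (x.1 + 1))

variable {x y : PretzelCrossing n}

theorem faceCode_north_iff :
    faceCode hn (x, 0) = .inr y ↔ x.1 = y.1 ∧ x.2.1 = y.2.1 + 1 := by
  obtain ⟨i, _ | j, hj⟩ := x
  · simp [faceCode]
  · simp only [faceCode, Nat.succ_ne_zero, if_false, Sum.inr.injEq, Nat.add_sub_cancel,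
      Nat.add_right_cancel_iff]
    exact ⟨by rintro rfl; exact ⟨rfl, rfl⟩, fun h => pretzelCrossing_ext h.1 h.2⟩

theorem faceCode_west_iff :
    faceCode hn (x, 1) = .inr y ↔ x.1 ≠ 0 ∧ x.1 = y.1 ∧ ¬ y.2.1 + 1 < (n y.1).natAbs := by
  by_cases h : x.1 = 0 <;> simp only [faceCode, h, if_true, if_false, reduceCtorEq, Sum.inr.injEq,
    pretzelBottom_eq_iff, ne_eq, not_true, not_false_iff, true_and, false_and]

theorem faceCode_south_iff :
    faceCode hn (x, 2) = .inr y ↔ if y.2.1 + 1 < (n y.1).natAbs then x = y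
      else y.1 = 0 ∧ ¬ x.2.1 + 1 < (n x.1).natAbs := by
  simp only [faceCode]
  split_ifs with hx hy hy
  · exact Sum.inr_injective.eq_iff
  · simp only [hx, not_true, and_false, iff_false, Sum.inr.injEq]
    rintro rfl
    exact hy hx
  · simp only [Sum.inr.injEq, pretzelBottom_eq_iff, hy, not_true, and_false, false_iff]
    rintro rfl
    exact hx hy
  · simp only [Sum.inr.injEq, pretzelBottom_eq_iff, hy, not_false_iff, and_true, hx]
    exact eq_comm

theorem faceCode_east_iff :
    faceCode hn (x, 3) = .inr y ↔ x.1 + 1 ≠ 0 ∧ x.1 + 1 = y.1 ∧ ¬ y.2.1 + 1 < (n y.1).natAbs := by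
  by_cases h : x.1 + 1 = 0 <;> simp only [faceCode, h, if_true, if_false, reduceCtorEq,
    Sum.inr.injEq, pretzelBottom_eq_iff, ne_eq, not_true, not_false_iff, true_and, false_and]

theorem faceCode_nextCorner (c : PretzelCrossing n × Fin 4) :
    faceCode hn ((pretzelDiagram n hn).nextCorner c) = faceCode hn c := by
  refine (pretzelEdge_cases hn
    (P := fun d d' => faceCode hn (d'.1, d'.2 - 1) = faceCode hn d ∧
      faceCode hn (d.1, d.2 - 1) = faceCode hn d')
    (fun _ _ h => ⟨h.2, h.1⟩) (fun d d' h => ?_) c).1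
  cases h with
  | top i => exact ⟨rfl, rfl⟩
  | bottom i =>
    refine ⟨rfl, ?_⟩
    exact (if_neg (pretzelBottom_not_lt hn i)).trans (if_neg (pretzelBottom_not_lt hn _)).symm
  | left i j h => exact ⟨(if_pos h).symm, rfl⟩
  | right i j h => exact ⟨rfl, if_pos h⟩

/-- A corner of the face with a given name. -/
def cornerOfCode : Bool ⊕ PretzelCrossing n → PretzelCrossing n × Fin 4
  | .inl true => (pretzelTop n hn 0, 0)
  | .inl false => (pretzelTop n hn 0, 1)
  | .inr x => (x, if x.2.1 + 1 < (n x.1).natAbs ∨ x.1 = 0 then 2 else 1)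

theorem faceCode_cornerOfCode (f : Bool ⊕ PretzelCrossing n) :
    faceCode hn (cornerOfCode hn f) = f := by
  match f with
  | .inl true | .inl false => simp [cornerOfCode, faceCode, pretzelTop]
  | .inr x =>
    simp only [cornerOfCode]
    split_ifs with h
    · rw [faceCode_south_iff]
      grind
    · rw [faceCode_west_iff]
      grind

theorem face_north_top (i : Fin k) : (pretzelDiagram n hn).face (pretzelTop n hn i, 0) =
    (pretzelDiagram n hn).face (pretzelTop n hn 0, 0) := by
  induction i using cyclic_induction with
  | zero => rfl
  | step i ih => exact (PretzelEdge.top i).face_eq.1.symm.trans ih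

theorem face_south_bottom (i : Fin k) : (pretzelDiagram n hn).face (pretzelBottom n hn i, 2) =
    (pretzelDiagram n hn).face (pretzelBottom n hn 0, 2) := by
  induction i using cyclic_induction with
  | zero => rfl
  | step i ih => exact (PretzelEdge.bottom i).face_eq.2.trans ih

theorem face_west (i : Fin k) (j : ℕ) (hj : j < (n i).natAbs) :
    (pretzelDiagram n hn).face (⟨i, j, hj⟩, 1) =
      (pretzelDiagram n hn).face (pretzelTop n hn i, 1) := by
  induction j with
  | zero => rfl
  | succ j ih => exact (PretzelEdge.left i j hj).face_eq.2.trans (ih _)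

theorem face_east (i : Fin k) (j : ℕ) (hj : j < (n i).natAbs) :
    (pretzelDiagram n hn).face (⟨i, j, hj⟩, 3) =
      (pretzelDiagram n hn).face (pretzelTop n hn (i + 1), 1) := by
  induction j with
  | zero => exact (PretzelEdge.top i).face_eq.2.symm
  | succ j ih => exact (PretzelEdge.right i j hj).face_eq.1.symm.trans (ih (by omega))

theorem face_cornerOfCode_faceCode (c : PretzelCrossing n × Fin 4) :
    (pretzelDiagram n hn).face (cornerOfCode hn (faceCode hn c)) =
      (pretzelDiagram n hn).face c := by
  have bottom (i : Fin k) :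
      (pretzelDiagram n hn).face (cornerOfCode hn (.inr (pretzelBottom n hn i))) =
        (pretzelDiagram n hn).face (pretzelBottom n hn i, if i = 0 then 2 else 1) := by
    have h := pretzelBottom_not_lt hn i
    simp only [cornerOfCode, pretzelBottom] at h ⊢
    simp only [h, false_or]
  obtain ⟨x, p⟩ := c
  match p with
  | 0 =>
    obtain ⟨i, _ | j, hj⟩ := x
    · exact (face_north_top hn i).symm
    · simpa [faceCode, cornerOfCode, hj] using (PretzelEdge.left i j hj).face_eq.1
  | 1 =>
    rw [face_west]
    by_cases h : x.1 = 0
    · simp only [faceCode, h, if_true, cornerOfCode]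
    · simp only [faceCode, h, if_false, bottom]
      exact face_west hn _ _ _
  | 2 =>
    by_cases h : x.2.1 + 1 < (n x.1).natAbs
    · simp [faceCode, cornerOfCode, h]
    · simp only [faceCode, h, if_false, bottom, if_true]
      rw [eq_pretzelBottom hn h, face_south_bottom hn x.1]
  | 3 =>
    rw [face_east]
    by_cases h : x.1 + 1 = 0
    · simp only [faceCode, if_true, cornerOfCode, h]
    · simp only [faceCode, h, if_false, bottom]
      exact face_west hn _ _ _

/-- The faces of the pretzel diagram, listed by their names. -/
def faceEquiv : (pretzelDiagram n hn).Face ≃ Bool ⊕ PretzelCrossing n where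
  toFun := Quot.lift (faceCode hn) (by rintro c _ rfl; exact (faceCode_nextCorner hn c).symm)
  invFun f := (pretzelDiagram n hn).face (cornerOfCode hn f)
  left_inv := by rintro ⟨c⟩; exact face_cornerOfCode_faceCode hn c
  right_inv := faceCode_cornerOfCode hn

theorem faceEquiv_upperDeck : faceEquiv hn (upperDeck n hn) = .inl true := rfl

theorem faceEquiv_universalFace : faceEquiv hn (universalFace n hn) = .inl false := rfl

/-- The crossings, as names of the faces of the balanced overlaid Tait graph. -/
def balancedFaceEquiv : PretzelCrossing n ≃
    {f : (pretzelDiagram n hn).Face // f ≠ upperDeck n hn ∧ f ≠ universalFace n hn} where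
  toFun x := ⟨(faceEquiv hn).symm (.inr x), by
    simp [Equiv.symm_apply_eq, faceEquiv_upperDeck, faceEquiv_universalFace]⟩
  invFun f := (faceEquiv hn f.1).elim (fun _ => pretzelTop n hn 0) id
  left_inv x := by simp
  right_inv f := by
    obtain ⟨f, h1, h2⟩ := f
    obtain ⟨f, rfl⟩ := (faceEquiv hn).symm.surjective f
    rcases f with (_ | _) | x
    · exact absurd rfl h2
    · exact absurd rfl h1
    · simp

theorem face_eq_balancedFaceEquiv_iff (c : PretzelCrossing n × Fin 4) (y : PretzelCrossing n) :
    (pretzelDiagram n hn).face c = (balancedFaceEquiv hn y).1 ↔ faceCode hn c = .inr y :=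
  (faceEquiv hn).eq_symm_apply

theorem face_eq_iff {c c' : PretzelCrossing n × Fin 4} :
    (pretzelDiagram n hn).face c = (pretzelDiagram n hn).face c' ↔
      faceCode hn c = faceCode hn c' :=
  (faceEquiv hn).injective.eq_iff.symm

end Faces

section Labels

variable {k : ℕ} [NeZero k] {n : Fin k → ℤ}

theorem pretzelLabel_lt_of_lt {x y : PretzelCrossing n} (h : x.1 < y.1) :
    pretzelLabel n x < pretzelLabel n y := by
  have hsum : ∑ i ∈ Finset.univ.filter (· < x.1), (n i).natAbs + (n x.1).natAbs ≤
      ∑ i ∈ Finset.univ.filter (· < y.1), (n i).natAbs := by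
    rw [add_comm, ← Finset.sum_insert (f := fun i => (n i).natAbs) (by simp)]
    refine Finset.sum_le_sum_of_subset fun i hi => ?_
    simp only [Finset.mem_insert, Finset.mem_filter, Finset.mem_univ, true_and] at hi ⊢
    exact hi.elim (fun hi => hi ▸ h) h.trans'
  have hy : y.1 ≠ 0 := (h.trans_le' (Fin.zero_le _)).ne'
  simp only [pretzelLabel, hy, if_false]
  split_ifs <;> omega

theorem pretzelLabel_le_iff {x y : PretzelCrossing n} :
    pretzelLabel n x ≤ pretzelLabel n y ↔
      x.1 < y.1 ∨ x.1 = y.1 ∧ if x.1 = 0 then x.2.1 ≤ y.2.1 else y.2.1 ≤ x.2.1 := by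
  rcases lt_trichotomy x.1 y.1 with h | h | h
  · simp only [h, true_or, (pretzelLabel_lt_of_lt h).le]
  · obtain ⟨i, j⟩ := x
    obtain ⟨i', j'⟩ := y
    obtain rfl : i = i' := h
    simp only [pretzelLabel, lt_irrefl, false_or, true_and]
    split_ifs <;> omega
  · simp only [h.not_gt, h.ne', false_and, or_false, (pretzelLabel_lt_of_lt h).not_ge]

theorem pretzelLabel_injective : Function.Injective (pretzelLabel n) := by
  intro x y h
  have h₁ := pretzelLabel_le_iff.1 h.le
  have h₂ := pretzelLabel_le_iff.1 h.ge
  have h₃ : x.1 = y.1 := by grind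
  exact pretzelCrossing_ext h₃ (by grind)

variable (hn : ∀ i, n i ≠ 0)

/-- The lowest labelled crossing that is incident with the face named by a crossing. -/
def lowestCrossing (y : PretzelCrossing n) : PretzelCrossing n :=
  if y.1 = 0 then y
  else if h : y.2.1 + 1 < (n y.1).natAbs then ⟨y.1, y.2.1 + 1, h⟩
  else if y.1 - 1 = 0 then pretzelTop n hn (y.1 - 1) else pretzelBottom n hn (y.1 - 1)

theorem lowestCrossing_of_zero {y : PretzelCrossing n} (hy : y.1 = 0) :
    lowestCrossing hn y = y :=
  if_pos hy

theorem lowestCrossing_bottom {i : Fin k} (hi : i ≠ 0) :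
    lowestCrossing hn (pretzelBottom n hn i) =
      if i - 1 = 0 then pretzelTop n hn (i - 1) else pretzelBottom n hn (i - 1) :=
  (if_neg hi).trans (dif_neg (pretzelBottom_not_lt hn i))

theorem exists_faceCode_lowestCrossing (y : PretzelCrossing n) :
    ∃ p, faceCode hn (lowestCrossing hn y, p) = .inr y := by
  unfold lowestCrossing
  split_ifs with h₀ h₁ h₂
  · exact ⟨2, (faceCode_south_iff hn).2 (by grind)⟩
  · exact ⟨0, (faceCode_north_iff hn).2 ⟨rfl, rfl⟩⟩
  all_goals exact ⟨3, (faceCode_east_iff hn).2 (by simp [pretzelTop, pretzelBottom, h₀, h₁])⟩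

theorem pretzelLabel_lowestCrossing_le {c : PretzelCrossing n × Fin 4} {y : PretzelCrossing n}
    (h : faceCode hn c = .inr y) :
    pretzelLabel n (lowestCrossing hn y) ≤ pretzelLabel n c.1 := by
  have hpos (i : Fin k) (hi : i ≠ 0) : 0 < i := Fin.pos_iff_ne_zero.2 hi
  have hpred {i : Fin k} : i ≠ 0 → i - 1 < i := fin_sub_one_lt_of_ne_zero
  obtain ⟨x, p⟩ := c
  unfold lowestCrossing
  match p with
  | 0 =>
    rw [faceCode_north_iff] at h
    split_ifs <;> rw [pretzelLabel_le_iff] <;> simp only [pretzelTop, pretzelBottom] <;> grind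
  | 1 =>
    rw [faceCode_west_iff] at h
    split_ifs <;> rw [pretzelLabel_le_iff] <;> simp only [pretzelTop, pretzelBottom] <;> grind
  | 2 =>
    rw [faceCode_south_iff] at h
    split_ifs <;> rw [pretzelLabel_le_iff] <;> simp only [pretzelTop, pretzelBottom] <;> grind
  | 3 =>
    rw [faceCode_east_iff] at h
    have hx : x.1 = y.1 - 1 := by rw [← h.2.1, add_sub_cancel_right]
    split_ifs <;> rw [pretzelLabel_le_iff] <;> simp only [pretzelTop, pretzelBottom, ← hx] <;> grind

theorem isLive_iff {c : PretzelCrossing n × Fin 4} {y : PretzelCrossing n}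
    (h : faceCode hn c = .inr y) :
    (pretzelDiagram n hn).IsLive (pretzelLabel n) c ↔ c.1 = lowestCrossing hn y := by
  obtain ⟨p, hp⟩ := exists_faceCode_lowestCrossing hn y
  have hle {c'} := pretzelLabel_lowestCrossing_le hn (c := c') (y := y)
  refine ⟨fun hc => pretzelLabel_injective (le_antisymm ?_ (hle h)), fun hc c' hc' => ?_⟩
  · exact hc (_, p) ((face_eq_iff hn).2 (hp.trans h.symm))
  · rw [hc]
    exact hle (((face_eq_iff hn).1 hc').trans h)

theorem isLive_south {x : PretzelCrossing n} :
    (pretzelDiagram n hn).IsLive (pretzelLabel n) (x, 2) ↔ x.1 = 0 := by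
  by_cases hx : x.2.1 + 1 < (n x.1).natAbs
  · rw [isLive_iff hn (show faceCode hn (x, 2) = .inr x from if_pos hx)]
    unfold lowestCrossing
    grind
  · rw [isLive_iff hn (show faceCode hn (x, 2) = .inr (pretzelBottom n hn 0) from if_neg hx),
      lowestCrossing_of_zero hn rfl, eq_comm, pretzelBottom_eq_iff, and_iff_left hx, eq_comm]

theorem isLive_north {x : PretzelCrossing n} (hx : x.2.1 ≠ 0) :
    (pretzelDiagram n hn).IsLive (pretzelLabel n) (x, 0) ↔ x.1 ≠ 0 := by
  rw [isLive_iff hn (show faceCode hn (x, 0) = .inr _ from if_neg hx), lowestCrossing]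
  grind

theorem not_isLive_west {x : PretzelCrossing n} (hx : x.1 ≠ 0) :
    ¬ (pretzelDiagram n hn).IsLive (pretzelLabel n) (x, 1) := by
  rw [isLive_iff hn (show faceCode hn (x, 1) = .inr _ from if_neg hx), lowestCrossing_bottom hn hx]
  intro h
  have h₁ := congrArg Sigma.fst h
  split_ifs at h₁ <;> exact (fin_sub_one_lt_of_ne_zero hx).ne' h₁

theorem isLive_east {x : PretzelCrossing n} (hx : x.1 + 1 ≠ 0) :
    (pretzelDiagram n hn).IsLive (pretzelLabel n) (x, 3) ↔
      if x.1 = 0 then x.2.1 = 0 else ¬ x.2.1 + 1 < (n x.1).natAbs := by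
  rw [isLive_iff hn (show faceCode hn (x, 3) = .inr _ from if_neg hx), lowestCrossing_bottom hn hx,
    add_sub_cancel_right]
  split_ifs
  · exact ⟨fun h => congrArg (·.2.1) h, eq_pretzelTop hn⟩
  · rw [eq_comm, pretzelBottom_eq_iff]
    exact and_iff_right rfl

/-- The variable `A` in the columns with `n i > 0`, and `A⁻¹` in the others: the variable in terms
of which the activity letters of a column do not depend on its sign. -/
noncomputable def columnVar (n : Fin k → ℤ) (i : Fin k) : (LaurentPolynomial ℤ)ˣ :=
  if 0 < n i then LinkDiagram.varA else LinkDiagram.varA⁻¹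

open Classical in
theorem activity_eval (x : PretzelCrossing n) (p : Fin 4) :
    ((pretzelDiagram n hn).activity (pretzelLabel n) (x, p)).eval =
      if (pretzelDiagram n hn).IsLive (pretzelLabel n) (x, p) then
        -(columnVar n x.1 ^ (if evenPos p then -3 else 3 : ℤ))
      else columnVar n x.1 ^ (if evenPos p then 1 else -1 : ℤ) := by
  have hblack : ((pretzelDiagram n hn).face (x, p)).black = evenPos p := rfl
  have htait : (pretzelDiagram n hn).taitPositive x = decide (0 < n x.1) := rfl
  simp only [LinkDiagram.activity, hblack, htait, columnVar]
  by_cases h1 : 0 < n x.1 <;> cases h2 : evenPos p <;>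
    by_cases h3 : (pretzelDiagram n hn).IsLive (pretzelLabel n) (x, p) <;>
    simp [h1, h3, LinkDiagram.ActivityLetter.eval]

end Labels

/-! ## Corner signs -/

namespace LinkDiagram

variable {C : Type} {D : LinkDiagram C}

/-- The product of the signs of the four corners at the two ends of an edge, for a sign `τ` on the
corners: the obstruction to `τ` being a product of signs of the crossings and signs of the faces. -/
def edgeSign (D : LinkDiagram C) (τ : C × Fin 4 → ℤˣ) (d : C × Fin 4) : ℤˣ :=
  τ d * τ (d.1, d.2 - 1) * (τ (D.nbr d) * τ ((D.nbr d).1, (D.nbr d).2 - 1))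

theorem edgeSign_mul (σ τ : C × Fin 4 → ℤˣ) (d : C × Fin 4) :
    D.edgeSign (fun c => σ c * τ c) d = D.edgeSign σ d * D.edgeSign τ d := by
  simp only [edgeSign]
  ac_rfl

/-- The sign `kappa` of a corner, as a unit of the integers. -/
def Orientation.cornerSign (o : D.Orientation) (c : C × Fin 4) : ℤˣ :=
  if o.out c = true ∧ o.out (c.1, c.2 + 1) = true then -1 else 1

theorem Orientation.kappa_eq (o : D.Orientation) (c : C × Fin 4) :
    ((o.kappa c : (LaurentPolynomial ℤ)ˣ) : LaurentPolynomial ℤ) = ((o.cornerSign c : ℤ) : _) := by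
  unfold kappa cornerSign
  split_ifs <;> simp

theorem Orientation.edgeSign_cornerSign (o : D.Orientation) (d : C × Fin 4) :
    D.edgeSign o.cornerSign d = -1 := by
  have hend (d : C × Fin 4) :
      o.cornerSign d * o.cornerSign (d.1, d.2 - 1) = if o.out d then -1 else 1 := by
    obtain ⟨x, p⟩ := d
    have hprev : o.out (x, p + 1) = !o.out (x, p - 1) := by
      rw [← o.out_opp, show p - 1 + 2 = p + 1 by grind]
    simp only [cornerSign, sub_add_cancel, hprev]
    cases o.out (x, p) <;> cases o.out (x, p - 1) <;> rfl
  rw [edgeSign, hend, hend, o.out_nbr]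
  cases o.out d <;> rfl

/-- The signs of the corners of a crossing in a standard pattern: `-1` at the northern and eastern
corners, `1` at the others. -/
def standardSign (p : Fin 4) : ℤˣ := if p = 0 ∨ p = 3 then -1 else 1

theorem edgeSign_standardSign (d : C × Fin 4) : D.edgeSign (fun c => standardSign c.2) d = -1 := by
  have h := D.nbr_parity d
  simp only [edgeSign]
  generalize (D.nbr d).2 = q at h ⊢
  generalize d.2 = p at h ⊢
  revert p q
  decide

theorem Orientation.edgeSign_cornerSign_mul_standardSign (o : D.Orientation) (d : C × Fin 4) :
    D.edgeSign (fun c => o.cornerSign c * standardSign c.2) d = 1 := by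
  rw [edgeSign_mul, edgeSign_cornerSign, edgeSign_standardSign]
  rfl

theorem Orientation.writheWeight_eq (o : D.Orientation) (x : C) :
    o.writheWeight x = (-(varA ^ (-3 : ℤ))) ^ o.sign x := by
  unfold writheWeight sign
  split_ifs
  · rw [zpow_one, Odd.neg_zpow (by decide)]
  · rw [Odd.neg_zpow (by decide), Odd.neg_zpow (by decide), ← zpow_mul]
    norm_num

theorem Orientation.prod_writheWeight [Fintype C] (o : D.Orientation) :
    ∏ x, o.writheWeight x = (-(varA ^ (-3 : ℤ))) ^ o.writhe := by
  simp only [writheWeight_eq, writhe]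
  exact (map_prod (zpowersHom (LaurentPolynomial ℤ)ˣ (-(varA ^ (-3 : ℤ))))
    (fun x => Multiplicative.ofAdd (o.sign x)) _).symm

end LinkDiagram

section Gauge

variable {k : ℕ} {n : Fin k → ℤ} (hn : ∀ i, n i ≠ 0)

/-- The sign of a crossing by which a sign `τ` on the corners has to be changed to become constant
to the west of each column and equal to `1` south of the columns. -/
def crossingGauge (τ : PretzelCrossing n × Fin 4 → ℤˣ) (x : PretzelCrossing n) : ℤˣ :=
  τ (x, 1) * (τ (pretzelBottom n hn x.1, 1) * τ (pretzelBottom n hn x.1, 2))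

/-- The sign `τ` on the corners after the change of the signs of the crossings by
`crossingGauge`. -/
def columnGauge (τ : PretzelCrossing n × Fin 4 → ℤˣ) (c : PretzelCrossing n × Fin 4) : ℤˣ :=
  τ c * crossingGauge hn τ c.1

variable {τ : PretzelCrossing n × Fin 4 → ℤˣ}

theorem columnGauge_west (i : Fin k) (j : ℕ) (hj : j < (n i).natAbs) :
    columnGauge hn τ (⟨i, j, hj⟩, 1) = columnGauge hn τ (pretzelBottom n hn i, 1) := by
  simp only [columnGauge, crossingGauge, ← mul_assoc, Int.units_mul_self]
  rfl

theorem columnGauge_south_bottom (i : Fin k) :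
    columnGauge hn τ (pretzelBottom n hn i, 2) = 1 := by
  simp only [columnGauge, crossingGauge, show (pretzelBottom n hn i).1 = i from rfl]
  rw [← mul_assoc (τ (pretzelBottom n hn i, 1)), Int.units_mul_self, one_mul, Int.units_mul_self]

variable [NeZero k] (hτ : ∀ d, (pretzelDiagram n hn).edgeSign τ d = 1)
include hτ

theorem columnGauge_flip {d d' : PretzelCrossing n × Fin 4} (h : PretzelEdge hn d d')
    (h' : columnGauge hn τ d' = columnGauge hn τ (d.1, d.2 - 1)) :
    columnGauge hn τ d = columnGauge hn τ (d'.1, d'.2 - 1) := by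
  have hd := hτ d
  rw [LinkDiagram.edgeSign, h.nbr_eq] at hd
  simp only [columnGauge] at h' ⊢
  generalize τ d = a, τ (d.1, d.2 - 1) = b, τ d' = a', τ (d'.1, d'.2 - 1) = b',
    crossingGauge hn τ d.1 = r, crossingGauge hn τ d'.1 = r' at *
  revert a b a' b' r r'
  decide

theorem columnGauge_bigon {i : Fin k} {j : ℕ} (hj : j + 1 < (n i).natAbs) :
    columnGauge hn τ (⟨i, j, Nat.lt_of_succ_lt hj⟩, 2) = columnGauge hn τ (⟨i, j + 1, hj⟩, 0) :=
  columnGauge_flip hn hτ (.left i j hj)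
    ((columnGauge_west hn i _ _).trans (columnGauge_west hn i _ _).symm)

theorem columnGauge_east (i : Fin k) (j : ℕ) (hj : j < (n i).natAbs) :
    columnGauge hn τ (⟨i, j, hj⟩, 3) = columnGauge hn τ (pretzelTop n hn i, 3) := by
  induction j with
  | zero => rfl
  | succ j ih =>
    exact (columnGauge_flip hn hτ (.right i j hj) (columnGauge_bigon hn hτ hj).symm).symm.trans
      (ih _)

theorem columnGauge_edge {d d' : PretzelCrossing n × Fin 4} (h : PretzelEdge hn d d') :
    columnGauge hn τ d' = columnGauge hn τ (d.1, d.2 - 1) := by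
  have bottom (i : Fin k) : columnGauge hn τ (pretzelBottom n hn (i + 1), 2) =
      columnGauge hn τ (pretzelBottom n hn i, 2) :=
    (columnGauge_south_bottom hn _).trans (columnGauge_south_bottom hn _).symm
  cases h with
  | top i =>
    exact (columnGauge_west hn _ _ _).trans
      ((columnGauge_flip hn hτ (.bottom i) (bottom i)).symm.trans (columnGauge_east hn hτ i _ _))
  | bottom i => exact bottom i
  | left i j hj => exact (columnGauge_west hn i _ _).trans (columnGauge_west hn i _ _).symm
  | right i j hj => exact (columnGauge_bigon hn hτ hj).symm

theorem columnGauge_nextCorner (c : PretzelCrossing n × Fin 4) :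
    columnGauge hn τ c = columnGauge hn τ ((pretzelDiagram n hn).nextCorner c) :=
  (pretzelEdge_cases hn
    (P := fun d d' => columnGauge hn τ d = columnGauge hn τ (d'.1, d'.2 - 1) ∧
      columnGauge hn τ d' = columnGauge hn τ (d.1, d.2 - 1))
    (fun _ _ h => h.symm)
    (fun _ _ h => ⟨columnGauge_flip hn hτ h (columnGauge_edge hn hτ h), columnGauge_edge hn hτ h⟩)
    c).1

theorem exists_gauge_of_edgeSign_eq_one :
    ∃ (r : PretzelCrossing n → ℤˣ) (f : (pretzelDiagram n hn).Face → ℤˣ),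
      ∀ c, τ c = r c.1 * f ((pretzelDiagram n hn).face c) := by
  refine ⟨crossingGauge hn τ,
    Quot.lift (columnGauge hn τ) fun c _ h => h ▸ columnGauge_nextCorner hn hτ c, fun c => ?_⟩
  change _ = _ * columnGauge hn τ c
  rw [columnGauge, mul_left_comm, Int.units_mul_self, mul_one]

end Gauge

section Standard

variable {k : ℕ} [NeZero k] {n : Fin k → ℤ} (hn : ∀ i, n i ≠ 0)

/-- The activity matrix without the writhe weights, with `standardSign` in place of `kappa`, and
with its columns indexed by the crossings by means of `balancedFaceEquiv`. -/
noncomputable def standardMatrix :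
    Matrix (PretzelCrossing n) (PretzelCrossing n) (LaurentPolynomial ℤ) :=
  Matrix.of fun x y => ∑ p : Fin 4, if faceCode hn (x, p) = .inr y then
    ((LinkDiagram.standardSign p : ℤ) : LaurentPolynomial ℤ) *
      (((pretzelDiagram n hn).activity (pretzelLabel n) (x, p)).eval : (LaurentPolynomial ℤ)ˣ)
    else 0

theorem exists_activityMatrix_eq_diagonal_mul (o : (pretzelDiagram n hn).Orientation) :
    ∃ r f : PretzelCrossing n → ℤˣ,
      (o.activityMatrix (pretzelLabel n) (upperDeck n hn) (universalFace n hn)).submatrix id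
          (balancedFaceEquiv hn) =
        Matrix.diagonal (fun x => (o.writheWeight x : LaurentPolynomial ℤ)) *
          (Matrix.diagonal (fun x => ((r x : ℤ) : LaurentPolynomial ℤ)) * standardMatrix hn *
            Matrix.diagonal (fun y => ((f y : ℤ) : LaurentPolynomial ℤ))) := by
  obtain ⟨r, f, hrf⟩ := exists_gauge_of_edgeSign_eq_one hn o.edgeSign_cornerSign_mul_standardSign
  have hsign (c) : o.cornerSign c =
      r c.1 * f ((pretzelDiagram n hn).face c) * LinkDiagram.standardSign c.2 := by
    rw [← hrf, mul_assoc, Int.units_mul_self, mul_one]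
  refine ⟨r, fun y => f (balancedFaceEquiv hn y).1, Matrix.ext fun x y => ?_⟩
  simp only [Matrix.diagonal_mul, Matrix.mul_diagonal, Matrix.submatrix_apply, id_eq,
    LinkDiagram.Orientation.activityMatrix, standardMatrix, Matrix.of_apply, Finset.mul_sum,
    Finset.sum_mul]
  refine Finset.sum_congr rfl fun p _ => ?_
  have hface := face_eq_balancedFaceEquiv_iff hn (x, p) y
  by_cases h : faceCode hn (x, p) = .inr y
  · rw [if_pos h, if_pos (hface.2 h), Units.val_mul, Units.val_mul, o.kappa_eq, hsign, hface.2 h]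
    push_cast
    ring
  · rw [if_neg h, if_neg (mt hface.1 h), mul_zero, zero_mul, mul_zero]

theorem exists_activityMatrix_det_eq (o : (pretzelDiagram n hn).Orientation)
    (e : PretzelCrossing n ≃
      {f : (pretzelDiagram n hn).Face // f ≠ upperDeck n hn ∧ f ≠ universalFace n hn}) :
    ∃ ε : ℤˣ,
      ((o.activityMatrix (pretzelLabel n) (upperDeck n hn) (universalFace n hn)).submatrix
        id e).det = ((ε : ℤ) : LaurentPolynomial ℤ) *
          (((-(LinkDiagram.varA ^ (-3 : ℤ))) ^ o.writhe : (LaurentPolynomial ℤ)ˣ) *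
            (standardMatrix hn).det) := by
  obtain ⟨r, f, h⟩ := exists_activityMatrix_eq_diagonal_mul hn o
  set M := o.activityMatrix (pretzelLabel n) (upperDeck n hn) (universalFace n hn)
  have hperm : M.submatrix id e = (M.submatrix id (balancedFaceEquiv hn)).submatrix id
      (e.trans (balancedFaceEquiv hn).symm) := by
    ext x y
    simp
  refine ⟨Equiv.Perm.sign (e.trans (balancedFaceEquiv hn).symm) * ((∏ x, r x) * ∏ y, f y), ?_⟩
  rw [hperm, Matrix.det_permute', h]
  simp only [Matrix.det_mul, Matrix.det_diagonal, ← o.prod_writheWeight, Units.coe_prod]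
  push_cast
  ring

end Standard

/-! ## The determinant of the standard matrix -/

section Determinant

variable {k : ℕ} (n : Fin k → ℤ)

/-- The factor `-A² - A⁻²` contributed to the bracket by a loop. -/
noncomputable def loopValue : LaurentPolynomial ℤ :=
  -((LinkDiagram.varA ^ (2 : ℤ) : (LaurentPolynomial ℤ)ˣ) : LaurentPolynomial ℤ) -
    ((LinkDiagram.varA ^ (-2 : ℤ) : (LaurentPolynomial ℤ)ˣ) : LaurentPolynomial ℤ)

theorem loopValue_ne_zero : loopValue ≠ 0 := by
  let ev := LaurentPolynomial.eval₂ (RingHom.id ℤ) 1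
  have hA : Units.map ev.toMonoidHom LinkDiagram.varA = 1 := by
    ext
    simp [ev, LinkDiagram.varA]
  have hpow (z : ℤ) : ev ((LinkDiagram.varA ^ z : (LaurentPolynomial ℤ)ˣ)) = 1 := by
    have := congrArg Units.val (map_zpow (Units.map ev.toMonoidHom) LinkDiagram.varA z)
    rwa [hA, one_zpow] at this
  intro h
  have := congrArg ev h
  rw [loopValue, map_sub, map_neg, hpow, hpow, map_zero] at this
  norm_num at this

theorem loopValue_eq (i : Fin k) :
    loopValue = -((columnVar n i ^ (2 : ℤ) : (LaurentPolynomial ℤ)ˣ) : LaurentPolynomial ℤ) -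
      ((columnVar n i ^ (-2 : ℤ) : (LaurentPolynomial ℤ)ˣ) : LaurentPolynomial ℤ) := by
  unfold loopValue columnVar
  split_ifs
  · rfl
  · rw [inv_zpow', inv_zpow', neg_neg, neg_sub_comm]

theorem loopValue_mul_columnVar (i : Fin k) :
    loopValue * columnVar n i =
      -((columnVar n i ^ (3 : ℤ) : (LaurentPolynomial ℤ)ˣ) : LaurentPolynomial ℤ) -
        (↑(columnVar n i)⁻¹ : LaurentPolynomial ℤ) := by
  rw [loopValue_eq n i, sub_mul, neg_mul, ← Units.val_mul, ← Units.val_mul, ← zpow_add_one,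
    ← zpow_add_one, ← zpow_neg_one]
  rfl

theorem loopValue_mul_inv_columnVar (i : Fin k) :
    loopValue * (↑(columnVar n i)⁻¹ : LaurentPolynomial ℤ) =
      -(columnVar n i : LaurentPolynomial ℤ) -
        ((columnVar n i ^ (-3 : ℤ) : (LaurentPolynomial ℤ)ˣ) : LaurentPolynomial ℤ) := by
  rw [loopValue_eq n i, sub_mul, neg_mul, ← Units.val_mul, ← Units.val_mul, ← zpow_sub_one,
    ← zpow_sub_one]
  norm_num

variable [NeZero k]

/-- The weight of the southern corners of a column. -/
noncomputable def southWeight (i : Fin k) : (LaurentPolynomial ℤ)ˣ :=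
  if i = 0 then -(columnVar n i ^ (-3 : ℤ)) else columnVar n i

/-- The weight of the northern corners of a column, except that of its top crossing. -/
noncomputable def northWeight (i : Fin k) : (LaurentPolynomial ℤ)ˣ :=
  if i = 0 then columnVar n i else -(columnVar n i ^ (-3 : ℤ))

variable {n}

/-- The crossing of a column that is live at the face to the east of the column. -/
def IsEastLive (x : PretzelCrossing n) : Prop :=
  if x.1 = 0 then x.2.1 = 0 else ¬ x.2.1 + 1 < (n x.1).natAbs

open Classical in
/-- The weight of the eastern corner of a crossing. -/
noncomputable def eastWeight (x : PretzelCrossing n) : (LaurentPolynomial ℤ)ˣ :=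
  if IsEastLive x then -(columnVar n x.1 ^ (3 : ℤ)) else (columnVar n x.1)⁻¹

variable (hn : ∀ i, n i ≠ 0)

theorem activity_eval_south (x : PretzelCrossing n) :
    ((pretzelDiagram n hn).activity (pretzelLabel n) (x, 2)).eval = southWeight n x.1 := by
  simp only [activity_eval, isLive_south, southWeight, evenPos]
  split_ifs <;> simp_all

theorem activity_eval_north {x : PretzelCrossing n} (hx : x.2.1 ≠ 0) :
    ((pretzelDiagram n hn).activity (pretzelLabel n) (x, 0)).eval = northWeight n x.1 := by
  simp only [activity_eval, isLive_north hn hx, northWeight, evenPos]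
  split_ifs <;> simp_all

theorem activity_eval_west {x : PretzelCrossing n} (hx : x.1 ≠ 0) :
    ((pretzelDiagram n hn).activity (pretzelLabel n) (x, 1)).eval = (columnVar n x.1)⁻¹ := by
  rw [activity_eval, if_neg (not_isLive_west hn hx)]
  exact zpow_neg_one _

theorem activity_eval_east {x : PretzelCrossing n} (hx : x.1 + 1 ≠ 0) :
    ((pretzelDiagram n hn).activity (pretzelLabel n) (x, 3)).eval = eastWeight x := by
  simp only [activity_eval, isLive_east hn hx, eastWeight, IsEastLive, evenPos]
  split_ifs <;> simp_all

theorem standardMatrix_apply (x y : PretzelCrossing n) :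
    standardMatrix hn x y =
      (if x.1 = y.1 ∧ x.2.1 = y.2.1 + 1 then -(northWeight n x.1 : LaurentPolynomial ℤ) else 0) +
      (if x.1 ≠ 0 ∧ x.1 = y.1 ∧ ¬ y.2.1 + 1 < (n y.1).natAbs then
        (↑(columnVar n x.1)⁻¹ : LaurentPolynomial ℤ) else 0) +
      (if if y.2.1 + 1 < (n y.1).natAbs then x = y else y.1 = 0 ∧ ¬ x.2.1 + 1 < (n x.1).natAbs then
        (southWeight n x.1 : LaurentPolynomial ℤ) else 0) +
      (if x.1 + 1 ≠ 0 ∧ x.1 + 1 = y.1 ∧ ¬ y.2.1 + 1 < (n y.1).natAbs then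
        -(eastWeight x : LaurentPolynomial ℤ) else 0) := by
  have sign_north : ((LinkDiagram.standardSign 0 : ℤ) : LaurentPolynomial ℤ) = -1 := by
    simp [LinkDiagram.standardSign]
  have sign_west : ((LinkDiagram.standardSign 1 : ℤ) : LaurentPolynomial ℤ) = 1 := by
    simp [LinkDiagram.standardSign]
  have sign_south : ((LinkDiagram.standardSign 2 : ℤ) : LaurentPolynomial ℤ) = 1 := by
    simp [LinkDiagram.standardSign]
  have sign_east : ((LinkDiagram.standardSign 3 : ℤ) : LaurentPolynomial ℤ) = -1 := by
    simp [LinkDiagram.standardSign]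
  simp only [standardMatrix, Matrix.of_apply, Fin.sum_univ_four, faceCode_north_iff,
    faceCode_west_iff, faceCode_south_iff, faceCode_east_iff, sign_north, sign_west, sign_south,
    sign_east, one_mul, neg_one_mul, activity_eval_south]
  congr 1
  · congr 2
    · split_ifs with h
      · rw [activity_eval_north hn (by omega)]
      · rfl
    · split_ifs with h
      · rw [activity_eval_west hn h.1]
      · rfl
  · split_ifs with h
    · rw [activity_eval_east hn h.1]
    · rfl

theorem hasBidiagonalBlocks_standardMatrix :
    HasBidiagonalBlocks (m := fun i => (n i).natAbs)
      (fun i => (southWeight n i : LaurentPolynomial ℤ))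
      (fun i => (northWeight n i : LaurentPolynomial ℤ)) (standardMatrix hn) := by
  intro x y hy
  simp only [standardMatrix_apply, hy, not_true, and_false, if_false, if_true, add_zero]
  obtain ⟨i, j⟩ := x
  obtain ⟨i', j'⟩ := y
  obtain rfl | hi := eq_or_ne i i'
  · obtain rfl | hj := eq_or_ne j j'
    · simp
    · simp [hj, Fin.val_inj]
  · simp [hi]

theorem standardMatrix_bottom (x : PretzelCrossing n) (i : Fin k) :
    standardMatrix hn x (pretzelBottom n hn i) =
      if i = 0 then
        if x.2.1 + 1 < (n x.1).natAbs then 0 else (southWeight n x.1 : LaurentPolynomial ℤ)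
      else if i = x.1 then (↑(columnVar n x.1)⁻¹ : LaurentPolynomial ℤ)
      else if i = x.1 + 1 then -(eastWeight x : LaurentPolynomial ℤ) else 0 := by
  have hlast : ¬ (x.1 = i ∧ x.2.1 = (pretzelBottom n hn i).2.1 + 1) := by
    rintro ⟨rfl, h⟩
    exact pretzelBottom_not_lt hn x.1 (h ▸ x.2.2)
  have hsucc (h : x.1 + 1 ≠ 0) : x.1 + 1 ≠ x.1 := (fin_lt_add_one_of_ne_zero h).ne'
  rw [standardMatrix_apply]
  simp only [show (pretzelBottom n hn i).1 = i from rfl, hlast, pretzelBottom_not_lt hn i,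
    if_false, zero_add, not_false_eq_true, and_true]
  split_ifs <;> grind

variable (n) in
/-- The sum over the crossings of a column of their western weights, each with the coefficient it
has in the elimination of the bigons of the column. -/
noncomputable def columnSum (i : Fin k) : LaurentPolynomial ℤ :=
  (∑ j : Fin (n i).natAbs, (southWeight n i : LaurentPolynomial ℤ) ^ j.1 *
    (northWeight n i : LaurentPolynomial ℤ) ^ ((n i).natAbs - 1 - j.1)) *
      (↑(columnVar n i)⁻¹ : LaurentPolynomial ℤ)

theorem loopValue_mul_columnSum (i : Fin k) :
    loopValue * columnSum n i =
      (-((columnVar n i ^ (-3 : ℤ) : (LaurentPolynomial ℤ)ˣ) : LaurentPolynomial ℤ)) ^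
          (n i).natAbs - (columnVar n i : LaurentPolynomial ℤ) ^ (n i).natAbs := by
  have geom := (Commute.all (southWeight n i : LaurentPolynomial ℤ)
    (northWeight n i)).geom_sum₂_mul (n i).natAbs
  rw [columnSum, Fin.sum_univ_eq_sum_range (fun j => (southWeight n i : LaurentPolynomial ℤ) ^ j *
    (northWeight n i : LaurentPolynomial ℤ) ^ ((n i).natAbs - 1 - j)), mul_left_comm,
    loopValue_mul_inv_columnVar]
  unfold southWeight northWeight at geom ⊢
  split_ifs at geom ⊢
  · rw [Units.val_neg] at geom ⊢
    linear_combination geom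
  · rw [Units.val_neg] at geom ⊢
    linear_combination -geom

include hn in
theorem sum_mul_eastWeight (i : Fin k) :
    ∑ j : Fin (n i).natAbs, (southWeight n i : LaurentPolynomial ℤ) ^ j.1 *
      (northWeight n i : LaurentPolynomial ℤ) ^ ((n i).natAbs - 1 - j.1) * eastWeight ⟨i, j⟩ =
        columnSum n i + loopValue * (columnVar n i : LaurentPolynomial ℤ) ^ (n i).natAbs := by
  classical
  have hpos := Int.natAbs_pos.2 (hn i)
  let live : Fin (n i).natAbs := if i = 0 then ⟨0, hpos⟩ else ⟨(n i).natAbs - 1, by omega⟩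
  have hlive (j : Fin (n i).natAbs) : IsEastLive (⟨i, j⟩ : PretzelCrossing n) ↔ j = live := by
    unfold IsEastLive
    grind
  have heast (j : Fin (n i).natAbs) : (eastWeight ⟨i, j⟩ : LaurentPolynomial ℤ) =
      (↑(columnVar n i)⁻¹ : LaurentPolynomial ℤ) +
        if j = live then loopValue * columnVar n i else 0 := by
    simp only [eastWeight, hlive, loopValue_mul_columnVar]
    split_ifs <;> simp
  have hpow : (southWeight n i : LaurentPolynomial ℤ) ^ live.1 *
      (northWeight n i : LaurentPolynomial ℤ) ^ ((n i).natAbs - 1 - live.1) =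
        (columnVar n i : LaurentPolynomial ℤ) ^ ((n i).natAbs - 1) := by
    simp only [live, southWeight, northWeight]
    split_ifs <;> simp
  simp only [heast, mul_add, Finset.sum_add_distrib, mul_ite, mul_zero, Finset.sum_ite_eq',
    Finset.mem_univ, if_true]
  rw [← Finset.sum_mul, hpow, mul_left_comm, pow_sub_one_mul hpos.ne']
  rfl

theorem sum_mul_standardMatrix_bottom (i i' : Fin k) :
    ∑ j : Fin (n i).natAbs, (southWeight n i : LaurentPolynomial ℤ) ^ j.1 *
      (northWeight n i : LaurentPolynomial ℤ) ^ ((n i).natAbs - 1 - j.1) *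
        standardMatrix hn ⟨i, j⟩ (pretzelBottom n hn i') =
      if i' = 0 then (southWeight n i : LaurentPolynomial ℤ) ^ (n i).natAbs
      else if i' = i then columnSum n i
      else if i' = i + 1 then
        -(columnSum n i + loopValue * (columnVar n i : LaurentPolynomial ℤ) ^ (n i).natAbs)
      else 0 := by
  have hpos := Int.natAbs_pos.2 (hn i)
  simp only [standardMatrix_bottom]
  split_ifs
  · rw [Fintype.sum_eq_single ⟨(n i).natAbs - 1, by omega⟩]
    · simp [Nat.sub_add_cancel hpos, pow_sub_one_mul hpos.ne']
    · intro j hj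
      have := Fin.val_ne_of_ne hj
      rw [if_pos (by grind), mul_zero]
  · rw [← Finset.sum_mul, columnSum]
  · simp only [mul_neg, Finset.sum_neg_distrib, sum_mul_eastWeight hn]
  · simp

theorem loopValue_mul_standardMatrix_det :
    loopValue * (standardMatrix hn).det =
      ∏ i, (columnSum n i + loopValue * (columnVar n i : LaurentPolynomial ℤ) ^ (n i).natAbs) +
        (loopValue ^ 2 - 1) * ∏ i, columnSum n i := by
  rw [(hasBidiagonalBlocks_standardMatrix hn).det_eq (fun i => Int.natAbs_pos.2 (hn i))
    fun i => (southWeight n i).ne_zero,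
    ← mul_det_borderedBidiagonal_of_first loopValue
      (fun i => (southWeight n i : LaurentPolynomial ℤ) ^ (n i).natAbs)
      (fun i => (columnVar n i : LaurentPolynomial ℤ) ^ (n i).natAbs) _ _ fun _ => rfl]
  · congr 2
    ext1 i i'
    simp only [borderedBidiagonal, Matrix.of_apply, Fin.val_eq_zero_iff]
    refine (sum_mul_standardMatrix_bottom hn i i').trans (ite_congr rfl (fun _ => rfl) fun h => ?_)
    simp only [fin_eq_add_one_iff h]
  · rw [loopValue_mul_columnSum, southWeight, if_pos rfl, Units.val_neg]
    ring
  · intro i hi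
    rw [southWeight, if_neg hi]

end Determinant

/-! ## The loops of a state -/

section Loops

section Levels

variable {k : ℕ} {n : Fin k → ℤ} (s : PretzelCrossing n → Bool)

/-- The smoothing chosen by a state joins north to west and south to east at a crossing. -/
def IsCut (x : PretzelCrossing n) : Prop := xor (s x) (decide (0 < n x.1)) = true

instance (x : PretzelCrossing n) : Decidable (IsCut s x) := inferInstanceAs (Decidable (_ = _))

/-- The number of the first `t` crossings of a column that are cut. -/
def cutsAbove (i : Fin k) (t : ℕ) : ℕ :=
  Nat.count (fun j => ∃ h : j < (n i).natAbs, IsCut s ⟨i, j, h⟩) t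

/-- The number of cut crossings in a column. -/
def cuts (i : Fin k) : ℕ := cutsAbove s i (n i).natAbs

variable {s}

theorem cutsAbove_zero (i : Fin k) : cutsAbove s i 0 = 0 :=
  Nat.count_zero _

theorem cutsAbove_le_cuts (i : Fin k) (t : Fin ((n i).natAbs + 1)) : cutsAbove s i t ≤ cuts s i :=
  Nat.count_monotone _ t.is_le

theorem cutsAbove_succ_of_isCut {x : PretzelCrossing n} (h : IsCut s x) :
    cutsAbove s x.1 (x.2 + 1) = cutsAbove s x.1 x.2 + 1 := by
  rw [cutsAbove, Nat.count_succ, if_pos ⟨x.2.2, h⟩, cutsAbove]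

theorem cutsAbove_succ_of_not_isCut {x : PretzelCrossing n} (h : ¬ IsCut s x) :
    cutsAbove s x.1 (x.2 + 1) = cutsAbove s x.1 x.2 := by
  rw [cutsAbove, Nat.count_succ, if_neg fun ⟨_, h'⟩ => h h', cutsAbove, add_zero]

theorem cuts_ne_zero_iff {i : Fin k} : cuts s i ≠ 0 ↔ ∃ j, IsCut s ⟨i, j⟩ := by
  rw [cuts, cutsAbove, Nat.count_ne_iff_exists]
  exact ⟨fun ⟨_, _, hj, h⟩ => ⟨⟨_, hj⟩, h⟩, fun ⟨j, h⟩ => ⟨j, j.2, j.2, h⟩⟩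

theorem exists_cutsAbove_eq {i : Fin k} {l : ℕ} (hl : l ≤ cuts s i) :
    ∃ t : Fin ((n i).natAbs + 1), cutsAbove s i t = l := by
  suffices ∀ t : Fin ((n i).natAbs + 1), l ≤ cutsAbove s i t →
      ∃ t' : Fin ((n i).natAbs + 1), cutsAbove s i t' = l from this (Fin.last _) hl
  intro t
  induction t using Fin.induction with
  | zero =>
    intro h
    exact ⟨0, by rw [Fin.val_zero, cutsAbove_zero] at h ⊢; omega⟩
  | succ j ih =>
    intro h
    by_cases hlt : l ≤ cutsAbove s i j
    · exact ih hlt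
    · refine ⟨j.succ, ?_⟩
      by_cases hc : IsCut s ⟨i, j⟩
      · have := cutsAbove_succ_of_isCut hc
        simp only [Fin.val_succ] at h this ⊢
        omega
      · exact absurd (h.trans_eq (cutsAbove_succ_of_not_isCut hc)) hlt

/-- The gaps above, between and below the crossings of the columns, each with a left (`false`) and
a right (`true`) side. -/
abbrev Level (n : Fin k → ℤ) : Type := Σ i : Fin k, Fin ((n i).natAbs + 1) × Bool

/-- The gap containing a corner, with its side. -/
def dartLevel : PretzelCrossing n × Fin 4 → Level n
  | (⟨i, j⟩, 0) => ⟨i, j.castSucc, true⟩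
  | (⟨i, j⟩, 1) => ⟨i, j.castSucc, false⟩
  | (⟨i, j⟩, 2) => ⟨i, j.succ, false⟩
  | (⟨i, j⟩, 3) => ⟨i, j.succ, true⟩

variable (hn : ∀ i, n i ≠ 0)

/-- A dart on a given side of a gap. -/
def levelDart : Level n → PretzelCrossing n × Fin 4
  | ⟨i, ⟨0, _⟩, r⟩ => (pretzelTop n hn i, if r then 0 else 1)
  | ⟨i, ⟨j + 1, h⟩, r⟩ => (⟨i, j, Nat.lt_of_succ_lt_succ h⟩, if r then 3 else 2)

theorem dartLevel_levelDart (l : Level n) :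
    dartLevel (levelDart hn l) = l := by
  obtain ⟨i, ⟨_ | t, h⟩, _ | _⟩ := l <;> rfl

theorem succ_pretzelBottom (i : Fin k) :
    Fin.succ (n := (n i).natAbs) (pretzelBottom n hn i).2 = Fin.last _ := by
  have := Int.natAbs_pos.2 (hn i)
  exact Fin.ext (Nat.sub_add_cancel this)

/-- A gap of a column below exactly `l` cuts. -/
noncomputable def cutGap {i : Fin k} {l : ℕ} (hl : l ≤ cuts s i) : Fin ((n i).natAbs + 1) :=
  (exists_cutsAbove_eq hl).choose

theorem cutsAbove_cutGap {i : Fin k} {l : ℕ} (hl : l ≤ cuts s i) :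
    cutsAbove s i (cutGap hl) = l :=
  (exists_cutsAbove_eq hl).choose_spec

variable [NeZero k] (s)

/-- The arcs of a smoothed pretzel diagram, as a relation on the sides of the gaps. -/
inductive LevelStep : Level n → Level n → Prop
  | past (i j r) (h : ¬ IsCut s ⟨i, j⟩) : LevelStep ⟨i, j.castSucc, r⟩ ⟨i, j.succ, r⟩
  | above (i j) (h : IsCut s ⟨i, j⟩) : LevelStep ⟨i, j.castSucc, true⟩ ⟨i, j.castSucc, false⟩
  | below (i j) (h : IsCut s ⟨i, j⟩) : LevelStep ⟨i, j.succ, true⟩ ⟨i, j.succ, false⟩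
  | top (i) : LevelStep ⟨i, 0, true⟩ ⟨i + 1, 0, false⟩
  | bottom (i) : LevelStep ⟨i, Fin.last _, true⟩ ⟨i + 1, Fin.last _, false⟩

theorem levelDart_dartLevel (d : PretzelCrossing n × Fin 4) :
    levelDart hn (dartLevel d) = d ∨
      levelDart hn (dartLevel d) = (pretzelDiagram n hn).nbr d := by
  obtain ⟨⟨i, j⟩, p⟩ := d
  match p with
  | 0 | 1 =>
    obtain ⟨_ | j, hj⟩ := j
    · exact .inl rfl
    · exact .inr rfl
  | 2 | 3 => exact .inl rfl

theorem dartLevel_nbr (d : PretzelCrossing n × Fin 4) :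
    Quot.mk (LevelStep s) (dartLevel d) =
      Quot.mk _ (dartLevel ((pretzelDiagram n hn).nbr d)) := by
  refine pretzelEdge_cases hn
    (P := fun d d' => Quot.mk (LevelStep s) (dartLevel d) = Quot.mk _ (dartLevel d'))
    (fun _ _ => Eq.symm) (fun d d' h => ?_) d
  cases h with
  | top i => exact Quot.sound (.top i)
  | bottom i =>
    have := Quot.sound (LevelStep.bottom (s := s) i)
    rwa [← succ_pretzelBottom hn, ← succ_pretzelBottom hn] at this
  | left i j h => rfl
  | right i j h => rfl

theorem smooth_of_isCut {x : PretzelCrossing n} (h : IsCut s x) (p : Fin 4) :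
    (pretzelDiagram n hn).smooth x (s x) p = LinkDiagram.smoothPos true p :=
  congrArg (LinkDiagram.smoothPos · p) h

theorem smooth_of_not_isCut {x : PretzelCrossing n} (h : ¬ IsCut s x)
    (p : Fin 4) : (pretzelDiagram n hn).smooth x (s x) p = LinkDiagram.smoothPos false p :=
  congrArg (LinkDiagram.smoothPos · p) (Bool.not_eq_true _ ▸ h)

theorem dartLevel_smooth (x : PretzelCrossing n) (p : Fin 4) :
    Quot.mk (LevelStep s) (dartLevel (x, p)) =
      Quot.mk _ (dartLevel (x, (pretzelDiagram n hn).smooth x (s x) p)) := by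
  obtain ⟨i, j⟩ := x
  by_cases h : IsCut s ⟨i, j⟩
  · rw [smooth_of_isCut s hn h]
    match p with
    | 0 => exact Quot.sound (.above i j h)
    | 1 => exact (Quot.sound (.above i j h)).symm
    | 2 => exact (Quot.sound (.below i j h)).symm
    | 3 => exact Quot.sound (.below i j h)
  · rw [smooth_of_not_isCut s hn h]
    match p with
    | 0 | 1 => exact Quot.sound (.past i j _ h)
    | 2 | 3 => exact (Quot.sound (.past i j _ h)).symm

theorem loop_smooth (x : PretzelCrossing n) (p : Fin 4) :
    Quot.mk ((pretzelDiagram n hn).LoopStep s) (x, p) =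
      Quot.mk _ (x, (pretzelDiagram n hn).smooth x (s x) p) :=
  Quot.sound (.inr rfl)

theorem loop_levelDart_dartLevel (d : PretzelCrossing n × Fin 4) :
    Quot.mk ((pretzelDiagram n hn).LoopStep s) (levelDart hn (dartLevel d)) = Quot.mk _ d := by
  rcases levelDart_dartLevel hn d with h | h
  · rw [h]
  · exact (Quot.sound (.inl h)).symm

theorem loop_levelDart_eq_of_step {l l' : Level n} (h : LevelStep s l l') :
    Quot.mk ((pretzelDiagram n hn).LoopStep s) (levelDart hn l) = Quot.mk _ (levelDart hn l') := by
  have loop_dart (d) := loop_levelDart_dartLevel s hn d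
  have of_smooth {x : PretzelCrossing n} {p q : Fin 4}
      (h : (pretzelDiagram n hn).smooth x (s x) p = q) :
      Quot.mk ((pretzelDiagram n hn).LoopStep s) (levelDart hn (dartLevel (x, p))) =
        Quot.mk _ (levelDart hn (dartLevel (x, q))) := by
    rw [loop_dart, loop_dart, loop_smooth, h]
  cases h with
  | past i j r h =>
    cases r
    · exact of_smooth (x := ⟨i, j⟩) (p := 1) (q := 2) (smooth_of_not_isCut s hn h _)
    · exact of_smooth (x := ⟨i, j⟩) (p := 0) (q := 3) (smooth_of_not_isCut s hn h _)
  | above i j h => exact of_smooth (x := ⟨i, j⟩) (p := 0) (q := 1) (smooth_of_isCut s hn h _)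
  | below i j h => exact of_smooth (x := ⟨i, j⟩) (p := 3) (q := 2) (smooth_of_isCut s hn h _)
  | top i => exact Quot.sound (.inl (PretzelEdge.top i).nbr_eq.symm)
  | bottom i =>
    rw [← succ_pretzelBottom hn, ← succ_pretzelBottom hn]
    exact Quot.sound (.inl (PretzelEdge.bottom i).nbr_eq.symm)

/-- The loops of a state as classes of sides of gaps. -/
def loopEquiv :
    Quot ((pretzelDiagram n hn).LoopStep s) ≃ Quot (LevelStep s) where
  toFun := Quot.lift (fun d => Quot.mk _ (dartLevel d)) <| by
    rintro d _ (rfl | rfl)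
    · exact dartLevel_nbr s hn d
    · exact dartLevel_smooth s hn d.1 d.2
  invFun := Quot.lift (fun l => Quot.mk _ (levelDart hn l)) fun _ _ =>
    loop_levelDart_eq_of_step s hn
  left_inv := by
    rintro ⟨d⟩
    exact loop_levelDart_dartLevel s hn d
  right_inv := by
    rintro ⟨l⟩
    exact congrArg _ (dartLevel_levelDart hn l)

end Levels

section OuterLoops

variable {k : ℕ} [NeZero k]

theorem cyclic_induction_from {P : Fin k → Prop} {u : Fin k} (base : P u)
    (step : ∀ i, P i → P (i + 1)) (i : Fin k) : P i := by
  have h : ∀ j, P (u + j) :=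
    cyclic_induction (by rwa [add_zero]) fun j hj => add_assoc u j 1 ▸ step _ hj
  simpa only [add_sub_cancel] using h (i - u)

theorem exists_cyclic_retraction {P : Fin k → Prop} (hP : ∃ i, P i) :
    ∃ U : Fin k → Fin k, (∀ i, P i → U i = i) ∧ ∀ i, ¬ P i → U i = U (i - 1) := by
  classical
  obtain ⟨u, hu⟩ := hP
  obtain ⟨k, rfl⟩ := Nat.exists_eq_succ_of_ne_zero (NeZero.ne k)
  let V : Fin (k + 1) → Fin (k + 1) := Fin.induction (motive := fun _ => Fin (k + 1)) u
    fun j v => if P (u + j.succ) then u + j.succ else v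
  have V_succ (j : Fin k) : V j.succ = if P (u + j.succ) then u + j.succ else V j.castSucc :=
    Fin.induction_succ ..
  have V_spec (j : Fin (k + 1)) :
      (P (u + j) → V j = u + j) ∧ (¬ P (u + j) → V j = V (j - 1)) := by
    cases j using Fin.cases with
    | zero => exact ⟨fun _ => (add_zero u).symm, fun h => absurd (by rwa [add_zero]) h⟩
    | succ j =>
      rw [V_succ, ← Fin.coeSucc_eq_succ, add_sub_cancel_right]
      exact ⟨fun h => if_pos h, fun h => if_neg h⟩
  refine ⟨fun i => V (i - u), fun i h => ?_, fun i h => ?_⟩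
  · simpa [h] using (V_spec (i - u)).1
  · simpa [h, sub_right_comm] using (V_spec (i - u)).2

/-- The arcs joining the columns of a pretzel diagram in which every column is either cut all
through (`c i`) or consists of two vertical strands.  The point `(i, b)` stands for the arc from
the column `i` to the next one, at the top if `b` holds and at the bottom otherwise. -/
inductive OuterStep (c : Fin k → Prop) : Fin k × Bool → Fin k × Bool → Prop
  | cut (i b) (h : c i) : OuterStep c (i, b) (i - 1, b)
  | left (i) (h : ¬ c i) : OuterStep c (i - 1, true) (i - 1, false)
  | right (i) (h : ¬ c i) : OuterStep c (i, true) (i, false)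

variable {c : Fin k → Prop}

theorem card_outerLoop_of_forall (h : ∀ i, c i) : Nat.card (Quot (OuterStep c)) = 2 := by
  have outer_eq (b : Bool) (i : Fin k) :
      Quot.mk (OuterStep c) (0, b) = Quot.mk (OuterStep c) (i, b) := by
    induction i using cyclic_induction with
    | zero => rfl
    | step i ih =>
      have := Quot.sound (OuterStep.cut (i + 1) b (h _))
      rw [add_sub_cancel_right] at this
      exact ih.trans this.symm
  let e : Quot (OuterStep c) ≃ Bool :=
    { toFun := Quot.lift Prod.snd <| by
        rintro _ _ (⟨_, _, _⟩ | ⟨_, h'⟩ | ⟨_, h'⟩)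
        · rfl
        · exact absurd (h _) h'
        · exact absurd (h _) h'
      invFun := fun b => Quot.mk _ (0, b)
      left_inv := by
        rintro ⟨i, b⟩
        exact outer_eq b i
      right_inv := fun _ => rfl }
  rw [Nat.card_congr e, Nat.card_eq_fintype_card, Fintype.card_bool]

theorem card_outerLoop_of_exists (h : ∃ i, ¬ c i) :
    Nat.card (Quot (OuterStep c)) = Nat.card {i // ¬ c i} := by
  obtain ⟨U, U_uncut, U_cut⟩ := exists_cyclic_retraction h
  simp only [not_not] at U_cut
  obtain ⟨u, hu⟩ := h
  have not_cut_U : ∀ i, ¬ c (U i) := by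
    refine cyclic_induction_from (u := u) (by rwa [U_uncut u hu]) fun i ih => ?_
    by_cases hi : c (i + 1)
    · rwa [U_cut _ hi, add_sub_cancel_right]
    · rwa [U_uncut _ hi]
  have outer_eq (b : Bool) :
      ∀ i, Quot.mk (OuterStep c) (U i, b) = Quot.mk (OuterStep c) (i, b) := by
    refine cyclic_induction_from (u := u) (by rw [U_uncut u hu]) fun i ih => ?_
    by_cases hi : c (i + 1)
    · rw [U_cut _ hi, Quot.sound (OuterStep.cut _ b hi), add_sub_cancel_right, ih]
    · rw [U_uncut _ hi]
  refine Nat.card_congr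
    { toFun := Quot.lift (fun a => ⟨U a.1, not_cut_U a.1⟩) ?_
      invFun := fun i => Quot.mk _ (i, true)
      left_inv := ?_
      right_inv := fun i => Subtype.ext (U_uncut i i.2) }
  · rintro _ _ (⟨i, _, hi⟩ | _ | _)
    · exact Subtype.ext (U_cut i hi)
    · rfl
    · rfl
  · rintro ⟨i, _ | _⟩
    · exact (Quot.sound (.right _ (not_cut_U i))).trans (outer_eq false i)
    · exact outer_eq true i

end OuterLoops

section LevelClasses

variable {k : ℕ} [NeZero k] {n : Fin k → ℤ} {s : PretzelCrossing n → Bool} {i : Fin k}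

theorem level_eq_of_cutsAbove_eq {t t' : Fin ((n i).natAbs + 1)}
    (h : cutsAbove s i t = cutsAbove s i t') (r : Bool) :
    Quot.mk (LevelStep s) ⟨i, t, r⟩ = Quot.mk _ ⟨i, t', r⟩ := by
  wlog hle : t ≤ t' generalizing t t'
  · exact (this h.symm (le_of_not_ge hle)).symm
  induction t' using Fin.induction with
  | zero => rw [Fin.le_zero_iff.1 hle]
  | succ j ih =>
    rcases hle.eq_or_lt with rfl | hlt
    · rfl
    have hle' : t ≤ j.castSucc := Fin.le_castSucc_iff.2 hlt
    by_cases hc : IsCut s ⟨i, j⟩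
    · have hmono : cutsAbove s i t ≤ cutsAbove s i j := Nat.count_monotone _ hle'
      have hsucc := cutsAbove_succ_of_isCut hc
      simp only [Fin.val_succ] at h hsucc
      omega
    · exact (ih (h.trans (cutsAbove_succ_of_not_isCut hc)) hle').trans
        (Quot.sound (.past i j r hc))

theorem level_side_eq (h : cuts s i ≠ 0) (t : Fin ((n i).natAbs + 1)) :
    Quot.mk (LevelStep s) ⟨i, t, true⟩ = Quot.mk _ ⟨i, t, false⟩ := by
  have side_iff (t : Fin ((n i).natAbs + 1)) :
      Quot.mk (LevelStep s) ⟨i, t, true⟩ = Quot.mk _ ⟨i, t, false⟩ ↔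
        Quot.mk (LevelStep s) ⟨i, 0, true⟩ = Quot.mk _ ⟨i, 0, false⟩ := by
    induction t using Fin.induction with
    | zero => rfl
    | succ j ih =>
      rw [← ih]
      by_cases hc : IsCut s ⟨i, j⟩
      · exact iff_of_true (Quot.sound (.below i j hc)) (Quot.sound (.above i j hc))
      · rw [Quot.sound (LevelStep.past i j true hc), Quot.sound (LevelStep.past i j false hc)]
  obtain ⟨j, hj⟩ := cuts_ne_zero_iff.1 h
  exact (side_iff t).2 ((side_iff _).1 (Quot.sound (.above i j hj)))

theorem level_top_left_eq (i : Fin k) :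
    Quot.mk (LevelStep s) ⟨i, 0, false⟩ = Quot.mk _ ⟨i - 1, 0, true⟩ := by
  have := Quot.sound (LevelStep.top (s := s) (i - 1))
  rw [sub_add_cancel] at this
  exact this.symm

theorem level_bottom_left_eq (i : Fin k) :
    Quot.mk (LevelStep s) ⟨i, Fin.last _, false⟩ = Quot.mk _ ⟨i - 1, Fin.last _, true⟩ := by
  have := Quot.sound (LevelStep.bottom (s := s) (i - 1))
  rw [sub_add_cancel] at this
  exact this.symm

theorem level_top_eq_bottom (h : cuts s i = 0) (r : Bool) :
    Quot.mk (LevelStep s) ⟨i, 0, r⟩ = Quot.mk _ ⟨i, Fin.last _, r⟩ :=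
  level_eq_of_cutsAbove_eq ((cutsAbove_zero i).trans h.symm) r

variable (s)

/-- The loops of a state: those between two consecutive cuts of a column, and those containing
arcs that join different columns. -/
abbrev LoopCode : Type := (Σ i, Fin (cuts s i - 1)) ⊕ Quot (OuterStep (cuts s · ≠ 0))

/-- The loop through a given side of a gap. -/
def levelCode : Level n → LoopCode s
  | ⟨i, t, r⟩ =>
    if h : 0 < cutsAbove s i t ∧ cutsAbove s i t < cuts s i then
      .inl ⟨i, cutsAbove s i t - 1, by omega⟩
    else .inr (Quot.mk _ (if r then i else i - 1, cutsAbove s i t = 0))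

variable {s}

theorem levelCode_of_eq_zero {t : Fin ((n i).natAbs + 1)} (h : cutsAbove s i t = 0) (r : Bool) :
    levelCode s ⟨i, t, r⟩ = .inr (Quot.mk _ (if r then i else i - 1, true)) := by
  simp [levelCode, h]

theorem levelCode_of_eq_cuts {t : Fin ((n i).natAbs + 1)} (h : cutsAbove s i t = cuts s i)
    (r : Bool) : levelCode s ⟨i, t, r⟩ = .inr (Quot.mk _ (if r then i else i - 1, false)) := by
  by_cases h0 : cuts s i = 0
  · rw [levelCode_of_eq_zero (h.trans h0)]
    cases r
    · exact congrArg _ (Quot.sound (.left i (not_not.2 h0)))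
    · exact congrArg _ (Quot.sound (.right i (not_not.2 h0)))
  · simp [levelCode, h, h0]

theorem levelCode_side_eq (h : cuts s i ≠ 0) (t : Fin ((n i).natAbs + 1)) :
    levelCode s ⟨i, t, true⟩ = levelCode s ⟨i, t, false⟩ := by
  by_cases hin : 0 < cutsAbove s i t ∧ cutsAbove s i t < cuts s i
  · simp [levelCode, hin]
  · simpa [levelCode, hin] using Quot.sound (OuterStep.cut i _ h)

theorem levelCode_eq_of_step {l l' : Level n} (h : LevelStep s l l') :
    levelCode s l = levelCode s l' := by
  cases h with
  | past i j r h =>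
    have h' : cutsAbove s i j.succ = cutsAbove s i j.castSucc := cutsAbove_succ_of_not_isCut h
    simp only [levelCode, h']
  | above i j h => exact levelCode_side_eq (cuts_ne_zero_iff.2 ⟨j, h⟩) _
  | below i j h => exact levelCode_side_eq (cuts_ne_zero_iff.2 ⟨j, h⟩) _
  | top i =>
    rw [levelCode_of_eq_zero (cutsAbove_zero i), levelCode_of_eq_zero (cutsAbove_zero _)]
    simp
  | bottom i =>
    rw [levelCode_of_eq_cuts rfl, levelCode_of_eq_cuts rfl]
    simp

variable (s)

/-- A side of a gap on a given loop. -/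
noncomputable def codeLevel : LoopCode s → Quot (LevelStep s)
  | .inl ⟨i, l⟩ => Quot.mk _ ⟨i, cutGap (s := s) (i := i) (l := l + 1) (by omega), true⟩
  | .inr a => a.lift (fun a => Quot.mk _ ⟨a.1, if a.2 then 0 else Fin.last _, true⟩) <| by
    rintro _ _ (⟨i, b, h⟩ | ⟨i, h⟩ | ⟨i, h⟩)
    · cases b
      · exact (level_side_eq h _).trans (level_bottom_left_eq i)
      · exact (level_side_eq h _).trans (level_top_left_eq i)
    · exact (level_top_left_eq i).symm.trans
        ((level_top_eq_bottom (not_not.1 h) false).trans (level_bottom_left_eq i))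
    · exact level_top_eq_bottom (not_not.1 h) true

theorem codeLevel_levelCode (l : Level n) : codeLevel s (levelCode s l) = Quot.mk _ l := by
  obtain ⟨i, t, r⟩ := l
  have hle := cutsAbove_le_cuts (s := s) i t
  rcases Nat.eq_zero_or_pos (cutsAbove s i t) with h0 | hpos
  · rw [levelCode_of_eq_zero h0,
      level_eq_of_cutsAbove_eq (t' := 0) (h0.trans (cutsAbove_zero i).symm)]
    cases r
    · exact (level_top_left_eq i).symm
    · rfl
  rcases hle.eq_or_lt with heq | hlt
  · rw [levelCode_of_eq_cuts heq, level_eq_of_cutsAbove_eq (t' := Fin.last _) heq]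
    cases r
    · exact (level_bottom_left_eq i).symm
    · rfl
  · have h (r : Bool) : codeLevel s (levelCode s ⟨i, t, r⟩) = Quot.mk _ ⟨i, t, true⟩ := by
      rw [levelCode, dif_pos ⟨hpos, hlt⟩]
      exact level_eq_of_cutsAbove_eq ((cutsAbove_cutGap _).trans (Nat.sub_add_cancel hpos)) true
    rw [h]
    cases r
    · exact level_side_eq (by omega) t
    · rfl

/-- The loops of a state in terms of the numbers of cuts in the columns. -/
noncomputable def levelEquiv : Quot (LevelStep s) ≃ LoopCode s where
  toFun := Quot.lift (levelCode s) fun _ _ => levelCode_eq_of_step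
  invFun := codeLevel s
  left_inv := by
    rintro ⟨l⟩
    exact codeLevel_levelCode s l
  right_inv := by
    rintro (⟨i, l⟩ | ⟨i, _ | _⟩)
    · have hl : l.1 + 1 < cuts s i := by omega
      have h := cutsAbove_cutGap hl.le
      exact (dif_pos ⟨by omega, by omega⟩).trans
        (congrArg (fun l => (.inl ⟨i, l⟩ : LoopCode s)) (Fin.ext (Nat.sub_eq_of_eq_add h)))
    · exact levelCode_of_eq_cuts rfl true
    · exact levelCode_of_eq_zero (cutsAbove_zero i) true

variable (hn : ∀ i, n i ≠ 0)

theorem loops_eq : (pretzelDiagram n hn).loops s =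
    ∑ i, (cuts s i - 1) + Nat.card (Quot (OuterStep (cuts s · ≠ 0))) := by
  rw [LinkDiagram.loops, Nat.card_congr ((loopEquiv s hn).trans (levelEquiv s)), Nat.card_sum,
    Nat.card_sigma]
  simp

theorem loops_of_exists_uncut (h : ∃ i, cuts s i = 0) : (pretzelDiagram n hn).loops s =
    ∑ i, (cuts s i - 1) + (Finset.univ.filter fun i => cuts s i = 0).card := by
  rw [loops_eq, card_outerLoop_of_exists (by simpa using h), Nat.card_eq_fintype_card,
    Fintype.card_subtype]
  simp

theorem loops_of_forall_cut (h : ∀ i, cuts s i ≠ 0) :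
    (pretzelDiagram n hn).loops s = ∑ i, (cuts s i - 1) + 2 := by
  rw [loops_eq, card_outerLoop_of_forall h]

end LevelClasses

end Loops

/-! ## The Kauffman bracket -/

section Bracket

section ColumnStates

variable {R : Type*} [CommRing R] {m : ℕ}

/-- The number of cut crossings in a choice of smoothings of a column. -/
def cutCount (c : Fin m → Bool) : ℕ := (Finset.univ.filter fun j => c j = true).card

/-- The weight of a choice of smoothings of a column in which an uncut crossing has weight `v` and
a cut one has weight `w`. -/
def columnStateWeight (v w : R) (c : Fin m → Bool) : R := ∏ j, if c j then w else v

/-- The contribution to a state sum of the `c - 1` loops between the `c` cuts of a column.  It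
vanishes for an uncut column, which does not separate the upper from the lower arcs. -/
def cutFactor (δ : R) (c : ℕ) : R := if c = 0 then 0 else δ ^ (c - 1)

/-- The state sum of a column over the smoothings that cut it. -/
def cutSum (δ v w : R) (m : ℕ) : R :=
  ∑ c : Fin m → Bool, columnStateWeight v w c * cutFactor δ (cutCount c)

variable (δ v w : R)

theorem mul_cutFactor (c : ℕ) : δ * cutFactor δ c = δ ^ c - 0 ^ c := by
  obtain _ | c := c <;> simp [cutFactor, pow_succ']

theorem sum_columnStateWeight_mul_pow :
    ∑ c : Fin m → Bool, columnStateWeight v w c * δ ^ cutCount c = (v + w * δ) ^ m := by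
  have weight_eq (c : Fin m → Bool) :
      columnStateWeight v w c * δ ^ cutCount c = ∏ j, if c j then w * δ else v := by
    simp only [columnStateWeight, cutCount, Finset.prod_ite, Finset.prod_const, mul_pow]
    ring
  have := Finset.prod_univ_sum (fun _ : Fin m => (Finset.univ : Finset Bool))
    (fun _ b => if b = true then w * δ else v)
  rw [Fintype.piFinset_univ] at this
  simp [weight_eq, ← this, add_comm]

theorem mul_cutSum (m : ℕ) : δ * cutSum δ v w m = (v + w * δ) ^ m - v ^ m := by
  have sum_zero := sum_columnStateWeight_mul_pow (m := m) 0 v w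
  rw [mul_zero, add_zero] at sum_zero
  rw [← sum_columnStateWeight_mul_pow, ← sum_zero, ← Finset.sum_sub_distrib, cutSum,
    Finset.mul_sum]
  exact Finset.sum_congr rfl fun c _ => by rw [mul_left_comm, mul_cutFactor, mul_sub]

theorem sum_columnStateWeight_mul_cutFactor_add (m : ℕ) :
    ∑ c : Fin m → Bool, columnStateWeight v w c *
      (cutFactor δ (cutCount c) + δ * 0 ^ cutCount c) = cutSum δ v w m + δ * v ^ m := by
  have sum_zero := sum_columnStateWeight_mul_pow (m := m) 0 v w
  rw [mul_zero, add_zero] at sum_zero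
  simp only [mul_add, Finset.sum_add_distrib, mul_left_comm _ δ, ← Finset.mul_sum, sum_zero]
  rfl

end ColumnStates

variable {k : ℕ} {n : Fin k → ℤ}

/-- States of the pretzel diagram in terms of cut crossings. -/
def stateEquiv (n : Fin k → ℤ) :
    (∀ i : Fin k, Fin (n i).natAbs → Bool) ≃ (PretzelCrossing n → Bool) where
  toFun c x := xor (c x.1 x.2) (decide (0 < n x.1))
  invFun s i j := xor (s ⟨i, j⟩) (decide (0 < n i))
  left_inv c := by simp
  right_inv s := by simp

open scoped Count in
theorem cuts_stateEquiv (c : ∀ i : Fin k, Fin (n i).natAbs → Bool) (i : Fin k) :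
    cuts (stateEquiv n c) i = cutCount (c i) := by
  rw [cuts, cutsAbove, Nat.count_eq_card_fintype, cutCount, ← Fintype.card_subtype]
  exact Fintype.card_congr
    { toFun := fun j => ⟨⟨j, j.2.1⟩, by simpa [IsCut, stateEquiv] using j.2.2.2⟩
      invFun := fun j => ⟨j, j.1.2, j.1.2, by simpa [IsCut, stateEquiv] using j.2⟩
      left_inv := fun _ => rfl
      right_inv := fun _ => rfl }

theorem prod_varA_stateEquiv (c : ∀ i : Fin k, Fin (n i).natAbs → Bool) :
    ((∏ x, if stateEquiv n c x then LinkDiagram.varA else LinkDiagram.varA⁻¹ :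
      (LaurentPolynomial ℤ)ˣ) : LaurentPolynomial ℤ) =
      ∏ i, columnStateWeight (columnVar n i : LaurentPolynomial ℤ) ↑(columnVar n i)⁻¹ (c i) := by
  rw [Units.coe_prod, Fintype.prod_sigma]
  refine Finset.prod_congr rfl fun i _ => Finset.prod_congr rfl fun j _ => ?_
  by_cases h : 0 < n i <;> cases hc : c i j <;> simp [stateEquiv, columnVar, h, hc]

variable [NeZero k]

theorem cutSum_eq_columnSum (i : Fin k) :
    cutSum loopValue (columnVar n i : LaurentPolynomial ℤ) ↑(columnVar n i)⁻¹ (n i).natAbs =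
      columnSum n i := by
  refine mul_left_cancel₀ loopValue_ne_zero ?_
  have := loopValue_mul_inv_columnVar n i
  rw [mul_cutSum, loopValue_mul_columnSum, mul_comm _ loopValue, this]
  congr 2
  ring

variable (hn : ∀ i, n i ≠ 0) (s : PretzelCrossing n → Bool)

theorem loops_ne_zero : (pretzelDiagram n hn).loops s ≠ 0 := by
  by_cases h : ∃ i, cuts s i = 0
  · rw [loops_of_exists_uncut s hn h]
    have : 0 < (Finset.univ.filter fun i => cuts s i = 0).card :=
      Finset.card_pos.2 (by simpa [Finset.Nonempty] using h)
    omega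
  · rw [loops_of_forall_cut s hn (not_exists.1 h)]
    omega

theorem pow_loops {R : Type*} [CommRing R] (δ : R) :
    δ ^ (pretzelDiagram n hn).loops s =
      ∏ i, (cutFactor δ (cuts s i) + δ * 0 ^ cuts s i) +
        (δ ^ 2 - 1) * ∏ i, cutFactor δ (cuts s i) := by
  by_cases h : ∃ i, cuts s i = 0
  · have prod_cutFactor : ∏ i, cutFactor δ (cuts s i) = 0 := by
      obtain ⟨i, hi⟩ := h
      exact Finset.prod_eq_zero (Finset.mem_univ i) (by simp [cutFactor, hi])
    have factor_eq (i) : cutFactor δ (cuts s i) + δ * 0 ^ cuts s i =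
        δ ^ (cuts s i - 1) * if cuts s i = 0 then δ else 1 := by
      unfold cutFactor
      split_ifs with hi <;> simp [hi]
    simp only [prod_cutFactor, loops_of_exists_uncut s hn h, factor_eq, Finset.prod_mul_distrib,
      Finset.prod_pow_eq_pow_sum, Finset.prod_ite, pow_add]
    simp
  · have hcut := not_exists.1 h
    simp only [loops_of_forall_cut s hn hcut, hcut, cutFactor, if_false, ne_eq, not_false_eq_true,
      zero_pow, mul_zero, add_zero, Finset.prod_pow_eq_pow_sum]
    ring

theorem loopValue_mul_bracket : loopValue * (pretzelDiagram n hn).bracket =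
    ∏ i, (cutSum loopValue (columnVar n i : LaurentPolynomial ℤ) ↑(columnVar n i)⁻¹ (n i).natAbs +
        loopValue * (columnVar n i : LaurentPolynomial ℤ) ^ (n i).natAbs) +
      (loopValue ^ 2 - 1) *
        ∏ i, cutSum loopValue (columnVar n i : LaurentPolynomial ℤ) ↑(columnVar n i)⁻¹
          (n i).natAbs := by
  have bracket_eq : (pretzelDiagram n hn).bracket = ∑ s : PretzelCrossing n → Bool,
      ((∏ x, if s x then LinkDiagram.varA else LinkDiagram.varA⁻¹ : (LaurentPolynomial ℤ)ˣ) :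
        LaurentPolynomial ℤ) * loopValue ^ ((pretzelDiagram n hn).loops s - 1) := rfl
  simp only [← sum_columnStateWeight_mul_cutFactor_add]
  simp only [cutSum, Finset.prod_univ_sum, Fintype.piFinset_univ]
  rw [bracket_eq, Finset.mul_sum, Finset.mul_sum,
    ← Finset.sum_add_distrib, ← (stateEquiv n).sum_comp]
  refine Finset.sum_congr rfl fun c _ => ?_
  rw [prod_varA_stateEquiv, mul_left_comm, mul_pow_sub_one (loops_ne_zero hn _), pow_loops]
  simp only [cuts_stateEquiv, Finset.prod_mul_distrib]
  ring

theorem standardMatrix_det : (standardMatrix hn).det = (pretzelDiagram n hn).bracket := by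
  refine mul_left_cancel₀ loopValue_ne_zero ?_
  rw [loopValue_mul_standardMatrix_det, loopValue_mul_bracket]
  simp only [cutSum_eq_columnSum]

end Bracket

theorem theorem4p2_general (k : ℕ) [NeZero k] (n : Fin k → ℤ) (hn : ∀ i, n i ≠ 0)
    (o : (pretzelDiagram n hn).Orientation) :
    Nonempty (PretzelCrossing n ≃
      {f : (pretzelDiagram n hn).Face // f ≠ upperDeck n hn ∧ f ≠ universalFace n hn}) ∧
    ∀ e : PretzelCrossing n ≃
        {f : (pretzelDiagram n hn).Face // f ≠ upperDeck n hn ∧ f ≠ universalFace n hn},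
      ((o.activityMatrix (pretzelLabel n) (upperDeck n hn) (universalFace n hn)).submatrix
          id e).det = o.jones ∨
      ((o.activityMatrix (pretzelLabel n) (upperDeck n hn) (universalFace n hn)).submatrix
          id e).det = -o.jones := by
  refine ⟨⟨balancedFaceEquiv hn⟩, fun e => ?_⟩
  obtain ⟨ε, hε⟩ := exists_activityMatrix_det_eq hn o e
  rw [hε, standardMatrix_det, ← LinkDiagram.Orientation.jones]
  rcases Int.units_eq_one_or ε with rfl | rfl
  · simp
  · simp

theorem theorem4p2 (k : ℕ) [NeZero k] (n : Fin k → ℤ) (hn : ∀ i, n i ≠ 0)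
    (hK : (pretzelDiagram n hn).IsKnot) (o : (pretzelDiagram n hn).Orientation) :
    Nonempty (PretzelCrossing n ≃
      {f : (pretzelDiagram n hn).Face // f ≠ upperDeck n hn ∧ f ≠ universalFace n hn}) ∧
    ∀ e : PretzelCrossing n ≃
        {f : (pretzelDiagram n hn).Face // f ≠ upperDeck n hn ∧ f ≠ universalFace n hn},
      ((o.activityMatrix (pretzelLabel n) (upperDeck n hn) (universalFace n hn)).submatrix
          id e).det = o.jones ∨
      ((o.activityMatrix (pretzelLabel n) (upperDeck n hn) (universalFace n hn)).submatrix
          id e).det = -o.jones := by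
  exact theorem4p2_general k n hn o
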